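/- Let $d,n\ge 1$, and let $\rho:\mathbb{R}^d\to(0,\infty)$ be a critical radius function, i.e. there are constants $C_0,N_0>0$ with $$C_0^{-1}\rho(x)\Big(1+\frac{|x-y|}{\rho(x)}\Big)^{-N_0}\le\rho(y)\le C_0\,\rho(x)\Big(1+\frac{|x-y|}{\rho(x)}\Big)^{\frac{N_0}{N_0+1}}\qquad(x,y\in\mathbb{R}^d).$$ For a cube $Q\subset\mathbb{R}^d$ with sides parallel to the axes, center $x_Q$ and side length $l_Q$, and for $\sigma\ge0$, put $\psi_\sigma(Q)=(1+l_Q/\rho(x_Q))^\sigma$. A matrix weight is a self-adjoint matrix function $W:\mathbb{R}^d\to\mathbb{C}^{n\times n}$ with locally integrable entries that is positive definite almost everywhere; its real powers are defined through its diagonalization. $|A|_{op}$ is the operator norm of a matrix $A$ with respect to the Hermitian norm of $\mathbb{C}^n$. A Young function is a continuous, increasing, convex function $\Phi:[0,\infty)\to[0,\infty)$ with $\Phi(0)=0$ and $\lim_{t\to\infty}\Phi(t)/t=\infty$. Its complementary function is $\bar\Phi(t)=\sup_{s>0}\{st-\Phi(s)\}$, and for a scalar function $g$ and a cube $Q$,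 $$\|g\|_{\Phi,Q}=\inf\Big\{\lambda>0:\frac1{|Q|}\int_Q\Phi\Big(\frac{|g(y)|}{\lambda}\Big)dy\le1\Big\}.$$ We write $\bar\Phi\in B_{p,q}$ if $\int_1^\infty\frac{\bar\Phi(t)^{q/p}}{t^q}\frac{dt}{t}<\infty$. Let $0<\theta'<\theta$, $0\le\alpha<d$, $1<p\le q<\infty$ and $1/p-1/q\le\alpha/d$, and let $\Phi$ be a Young function with $\bar\Phi\in B_{p,q}$. Then there is a constant $C<\infty$, depending only on $d,n,C_0,N_0,\theta,\theta',\alpha,p,q,\Phi$, such that for every critical radius function $\rho$ with constants $C_0,N_0$ and every pair $(U,V)$ of matrix weights with $$[U,V]_{p,q,\alpha,\psi_{\theta'},\Phi}:=\sup_Q\frac{|Q|^{\alpha/d+1/q-1/p}}{\psi_{\theta'/3}(Q)^{1-\alpha/d}}\Big(\frac1{|Q|}\int_Q\big\|\,|U(x)^{1/q}V(\cdot)^{-1/q}|_{op}\big\|_{\Phi,Q}^q\,dx\Big)^{1/q}<\infty,$$ the maximal operator $$M_{U,V,\psi_\theta,\alpha}\vec f(x):=\sup_{Q\ni x}\frac1{(\psi_\theta(Q)|Q|)^{1-\alpha/d}}\int_Q|U(x)^{1/q}V(y)^{-1/q}\vec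 f(y)|\,dy$$ satisfies, for every $\vec f\in L^p(\mathbb{R}^d,\mathbb{C}^n)$, that $M_{U,V,\psi_\theta,\alpha}\vec f$ is (Lebesgue) measurable and $$\|M_{U,V,\psi_\theta,\alpha}\vec f\|_{L^q}\le C\,[U,V]_{p,q,\alpha,\psi_{\theta'},\Phi}\,\|\vec f\|_{L^p}.$$ -/

import Mathlib

open MeasureTheory Set Filter Topology
open scoped NNReal ENNReal ComplexOrder

/-- `ρ : ℝᵈ → (0,∞)` is a critical radius function with constants `C₀` and `N₀`. -/
structure IsCriticalRadius {d : ℕ} (C₀ N₀ : ℝ) (ρ : EuclideanSpace ℝ (Fin d) → ℝ) : Prop where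
  pos : ∀ x, 0 < ρ x
  lower : ∀ x y, C₀⁻¹ * ρ x * (1 + ‖x - y‖ / ρ x) ^ (-N₀) ≤ ρ y
  upper : ∀ x y, ρ y ≤ C₀ * ρ x * (1 + ‖x - y‖ / ρ x) ^ (N₀ / (N₀ + 1))

/-- The cube `Q(c, r)` with sides parallel to the axes, center `c` and side length `2 r`. (The
suprema over cubes below are the same for open and for closed cubes.) -/
def cube {d : ℕ} (c : EuclideanSpace ℝ (Fin d)) (r : ℝ) : Set (EuclideanSpace ℝ (Fin d)) :=
  {y | ∀ i, |y i - c i| < r}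

/-- `ψ_θ(Q) = (1 + l_Q / ρ(x_Q)) ^ θ` for the cube `Q = Q(c, r)`. -/
noncomputable def psi {d : ℕ} (ρ : EuclideanSpace ℝ (Fin d) → ℝ) (θ : ℝ)
    (c : EuclideanSpace ℝ (Fin d)) (r : ℝ) : ℝ :=
  (1 + 2 * r / ρ c) ^ θ

/-- A matrix weight on `ℝᵈ`: a self-adjoint `n × n` matrix function with locally integrable
entries that is positive definite almost everywhere. -/
structure IsMatrixWeight {d n : ℕ}
    (W : EuclideanSpace ℝ (Fin d) → Matrix (Fin n) (Fin n) ℂ) : Prop where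
  selfAdjoint : ∀ x, (W x).IsHermitian
  locallyIntegrable : ∀ i j, LocallyIntegrable (fun x => W x i j) volume
  posDef : ∀ᵐ x ∂volume, (W x).PosDef

/-- The real power `A ^ r` of a self-adjoint matrix, i.e. `O D(λᵢ ^ r) O*` for a diagonalization
`A = O D(λᵢ) O*` with `O` unitary (the functional calculus of `t ↦ t ^ r`). -/
noncomputable def matPow {n : ℕ} (A : Matrix (Fin n) (Fin n) ℂ) (r : ℝ) :
    Matrix (Fin n) (Fin n) ℂ :=
  cfc (fun t : ℝ => t ^ r) A

/-- The action of a matrix on `ℂⁿ` with its Hermitian norm. The norm of `matCLM A` is the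
operator norm `|A|_op`. -/
noncomputable def matCLM {n : ℕ} (A : Matrix (Fin n) (Fin n) ℂ) :
    EuclideanSpace ℂ (Fin n) →L[ℂ] EuclideanSpace ℂ (Fin n) :=
  Matrix.toEuclideanCLM (n := Fin n) (𝕜 := ℂ) A

/-- Young functions on `[0,∞)` (only the values of `Φ` on `[0,∞)` are used). -/
structure IsYoungFunction (Φ : ℝ → ℝ) : Prop where
  continuousOn : ContinuousOn Φ (Ici 0)
  monotoneOn : MonotoneOn Φ (Ici 0)
  convexOn : ConvexOn ℝ (Ici 0) Φ
  map_zero : Φ 0 = 0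
  superlinear : Tendsto (fun t => Φ t / t) atTop atTop

/-- The complementary function `Φ̄(t) = sup_{s > 0} (s t - Φ(s))`; the supremum is over a nonempty
set that is bounded above when `Φ` is a Young function. -/
noncomputable def complementary (Φ : ℝ → ℝ) (t : ℝ) : ℝ :=
  ⨆ s : Ioi (0 : ℝ), ((s : ℝ) * t - Φ s)

/-- The class `B_{p,q}`: `∫_1^∞ Ψ(t)^{q/p} / t^q dt/t < ∞`. -/
def InBpq (p q : ℝ) (Ψ : ℝ → ℝ) : Prop :=
  ∫⁻ t in Ioi (1 : ℝ), ENNReal.ofReal (Ψ t ^ (q / p) / t ^ q / t) < ∞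

/-- The localized Orlicz norm `‖g‖_{Φ,Q} = inf {s > 0 : |Q|⁻¹ ∫_Q Φ(|g| / s) ≤ 1}` in `[0,∞]`. -/
noncomputable def orliczNorm {d : ℕ} (Φ : ℝ → ℝ) (Q : Set (EuclideanSpace ℝ (Fin d)))
    (g : EuclideanSpace ℝ (Fin d) → ℝ) : ℝ≥0∞ :=
  ⨅ (s : ℝ) (_ : 0 < s)
    (_ : (volume Q)⁻¹ * ∫⁻ y in Q, ENNReal.ofReal (Φ (|g y| / s)) ≤ 1), ENNReal.ofReal s

/-- The quantity
`sup_Q |Q|^{α/d+1/q-1/p} ψ_σ(Q)^{-(1-α/d)} (|Q|⁻¹ ∫_Q ‖U(x)^{1/q} V^{-1/q}‖_{Φ,Q}^q dx)^{1/q}`. -/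
noncomputable def bumpConst {d n : ℕ} (ρ : EuclideanSpace ℝ (Fin d) → ℝ) (σ α p q : ℝ)
    (Φ : ℝ → ℝ) (U V : EuclideanSpace ℝ (Fin d) → Matrix (Fin n) (Fin n) ℂ) : ℝ≥0∞ :=
  ⨆ (c : EuclideanSpace ℝ (Fin d)) (r : ℝ) (_ : 0 < r),
    ENNReal.ofReal (volume.real (cube c r) ^ (α / d + 1 / q - 1 / p) /
        psi ρ σ c r ^ (1 - α / d)) *
      ((volume (cube c r))⁻¹ * ∫⁻ x in cube c r,
        orliczNorm Φ (cube c r)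
          (fun y => ‖matCLM (matPow (U x) (1 / q) * matPow (V y) (-1 / q))‖) ^ q) ^ (1 / q)

/-- The two-weight fractional maximal operator `M_{U,V,ψ_θ,α}`, with values in `[0,∞]`. -/
noncomputable def maximalOp {d n : ℕ} (ρ : EuclideanSpace ℝ (Fin d) → ℝ) (θ α q : ℝ)
    (U V : EuclideanSpace ℝ (Fin d) → Matrix (Fin n) (Fin n) ℂ)
    (f : EuclideanSpace ℝ (Fin d) → EuclideanSpace ℂ (Fin n))
    (x : EuclideanSpace ℝ (Fin d)) : ℝ≥0∞ :=
  ⨆ (c : EuclideanSpace ℝ (Fin d)) (r : ℝ) (_ : 0 < r) (_ : x ∈ cube c r),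
    ENNReal.ofReal (1 / (psi ρ θ c r * volume.real (cube c r)) ^ (1 - α / d)) *
      ∫⁻ y in cube c r,
        ‖matCLM (matPow (U x) (1 / q) * matPow (V y) (-1 / q)) (f y)‖ₑ

/-! The operator sees the data only through the vector function `h = V^(-1/q) f` and, at each point
`x`, through the single matrix `A(x) = U(x)^(1/q)`. The core is a sparse domination that is uniform
in the matrix: from a finite laminar family of cubes one selects a Carleson subfamily, depending on
`h` alone, whose averages of `|A h|` dominate those over all the cubes for every `A` at once
(`exists_sparse`). Uniformity comes from finite dimension. `A ↦ ∫_R |A h|` is a seminorm on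
matrices, and in a basis adapted to it, with constants depending only on the dimension, it suffices
to stop on the averages of the finitely many basis matrices. As the selection does not depend on
`x`, the integral in `x` can be taken cube by cube.

On a selected cube `R`, Hölder's inequality for complementary Young functions separates `∫_R |A(x)
h|` into `‖ |A(x) V^(-1/q)|_op ‖_{Φ,R}`, whose `q`-th power is integrated by the bump hypothesis,
and an Orlicz size of `|f|` on `R` relative to the complementary function. What remains is a sum
over the Carleson family of `q`-th powers of these sizes, weighted by `|R|^(q/p)`. It is at most a
multiple of `‖f‖_p^q` by the dyadic form of the condition `B_{p,q}` (`IsLaminar.sum_level_le`), so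
no bound for an Orlicz maximal operator is needed.

General cubes are reduced to `2^d` shifted dyadic grids by the one-third trick, and sorted by the
integer `j` with `2^j ≤ 1 + l_Q / ρ(x_Q) < 2^(j+1)`. With `β = 1 - α/d`, the operator contributes
`2^(-jθβ)` and the bump constant costs `2^(jθ'β/3)`. As `θ'/3 < θ`, the sum over `j` is geometric.
Measurability holds because the supremum over open cubes is lower semicontinuous jointly in the
point and the matrix. -/

/-! ### Adapted bases for seminorms -/

/-- A basis adapted to a seminorm (with a constant that depends on the dimension only). -/
theorem Seminorm.exists_adapted_basis (m : ℕ) : ∃ C : ℝ, 0 ≤ C ∧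
    ∀ (E : Type) [AddCommGroup E] [Module ℝ E] [FiniteDimensional ℝ E] (ν : Seminorm ℝ E),
      Module.finrank ℝ E = m →
      ∃ (b : Fin m → E) (φ : Fin m → E →ₗ[ℝ] ℝ),
        ∀ x, x = ∑ i, φ i x • b i ∧ ∀ i, |φ i x| * ν (b i) ≤ C * ν x := by
  induction m with
  | zero =>
    refine ⟨0, le_rfl, fun E _ _ _ ν hE => ⟨Fin.elim0, Fin.elim0, fun x => ⟨?_, fun i => i.elim0⟩⟩⟩
    have := Module.finrank_zero_iff.1 hE
    simpa using Subsingleton.elim x 0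
  | succ m ih =>
    obtain ⟨C, hC0, hC⟩ := ih
    -- Split off a vector `e` with a Hahn–Banach norming functional `f` and recurse on `ker f`. The
    -- projection `x - f x • e` at most doubles `ν`, whence `2 * C`; the `1` covers `e` itself. The
    -- product form `|φ i x| * ν (b i)` lets some `ν (b i)` vanish, so null vectors of `ν` do no
    -- harm.
    refine ⟨1 + 2 * C, by positivity, fun E _ _ _ ν hE => ?_⟩
    have hpos : 0 < Module.finrank ℝ E := by omega
    have : Nontrivial E := Module.nontrivial_of_finrank_pos hpos
    -- a nonzero vector `e` and a functional `f` with `f e = 1` and `|f x| * ν e ≤ ν x`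
    obtain ⟨e, f, hfe, hf⟩ : ∃ (e : E) (f : E →ₗ[ℝ] ℝ), f e = 1 ∧ ∀ x, |f x| * ν e ≤ ν x := by
      by_cases hν : ∃ e, ν e ≠ 0
      · obtain ⟨e, he⟩ := hν
        have he' : 0 < ν e := lt_of_le_of_ne (apply_nonneg ν e) (Ne.symm he)
        have he0 : e ≠ 0 := fun h => he (by rw [h]; exact map_zero ν)
        obtain ⟨g, hg1, hg2⟩ := exists_extension_of_le_sublinear
          (LinearPMap.mkSpanSingleton e (ν e) he0) ν
          (fun c hc x => by rw [map_smul_eq_mul, Real.norm_of_nonneg hc.le])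
          (fun x y => map_add_le_add ν x y)
          (by
            rintro ⟨x, hx⟩
            obtain ⟨c, rfl⟩ := Submodule.mem_span_singleton.1 hx
            rw [LinearPMap.mkSpanSingleton'_apply]
            simp only [smul_eq_mul, map_smul_eq_mul]
            exact mul_le_mul_of_nonneg_right (le_abs_self c) he'.le)
        have hge : g e = ν e := by
          have := hg1 ⟨e, Submodule.mem_span_singleton_self e⟩
          rw [this]
          exact LinearPMap.mkSpanSingleton_apply ℝ ℝ he0 (ν e)
        refine ⟨e, (ν e)⁻¹ • g, ?_, fun x => ?_⟩
        · simp [hge, he]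
        · have hgx : |g x| ≤ ν x := by
            rw [abs_le]
            have := hg2 (-x)
            rw [map_neg, map_neg_eq_map] at this
            exact ⟨by linarith, hg2 x⟩
          simp only [LinearMap.smul_apply, smul_eq_mul, abs_mul, abs_inv, abs_of_pos he']
          calc (ν e)⁻¹ * |g x| * ν e = |g x| := by field_simp
            _ ≤ ν x := hgx
      · push Not at hν
        obtain ⟨e, he⟩ := exists_ne (0 : E)
        obtain ⟨f, hf⟩ : ∃ f : Module.Dual ℝ E, f e ≠ 0 := by
          by_contra! h
          exact he ((Module.forall_dual_apply_eq_zero_iff ℝ e).1 h)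
        exact ⟨e, (f e)⁻¹ • f, by simp [hf], fun x => by simp [hν]⟩
    have hker : Module.finrank ℝ (LinearMap.ker f) = m := by
      have h1 := f.finrank_range_add_finrank_ker
      have h2 : LinearMap.range f = ⊤ := LinearMap.range_eq_top.2 fun c =>
        ⟨c • e, by simp [hfe]⟩
      rw [h2, finrank_top, Module.finrank_self] at h1
      omega
    obtain ⟨b, φ, hb⟩ := hC (LinearMap.ker f) (ν.comp (LinearMap.ker f).subtype) hker
    let π : E →ₗ[ℝ] LinearMap.ker f :=
      LinearMap.codRestrict (LinearMap.ker f) (LinearMap.id - f.smulRight e)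
        (fun x => by simp [hfe])
    have hπ : ∀ x, ((π x : LinearMap.ker f) : E) = x - f x • e := fun x => rfl
    refine ⟨Fin.cons e fun i => (b i : E), Fin.cons f fun i => (φ i).comp π, fun x => ⟨?_, ?_⟩⟩
    · rw [Fin.sum_univ_succ]
      have h1 := congrArg (Subtype.val) (hb (π x)).1
      rw [hπ] at h1
      simp only [Fin.cons_zero, Fin.cons_succ, LinearMap.comp_apply]
      rw [sub_eq_iff_eq_add'] at h1
      simpa using h1
    · intro i
      refine Fin.cases ?_ (fun i => ?_) i
      · simp only [Fin.cons_zero]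
        have := hf x
        have h2 := mul_nonneg hC0 (apply_nonneg ν x)
        linarith
      · simp only [Fin.cons_succ, LinearMap.comp_apply]
        have h1 := (hb (π x)).2 i
        simp only [Seminorm.comp_apply, Submodule.subtype_apply, hπ] at h1
        have h2 : ν (x - f x • e) ≤ 2 * ν x := by
          have h3 := map_sub_le_add ν x (f x • e)
          rw [map_smul_eq_mul, Real.norm_eq_abs] at h3
          linarith [hf x]
        have h4 := mul_le_mul_of_nonneg_left h2 hC0
        linarith [apply_nonneg ν x]

/-! ### Laminar families and the Carleson condition -/

/-- Any two members of the family are nested or disjoint. -/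
def IsLaminar {X : Type*} (F : Set (Set X)) : Prop :=
  ∀ S ∈ F, ∀ R ∈ F, Disjoint S R ∨ S ⊆ R ∨ R ⊆ S

theorem IsLaminar.mono {X : Type*} {F G : Set (Set X)} (hG : IsLaminar G) (h : F ⊆ G) :
    IsLaminar F := fun S hS R hR => hG S (h hS) R (h hR)

/-- Induction on finite families of sets by adding a minimal set. -/
theorem Finset.induction_on_minimal {X : Type*} [DecidableEq (Set X)] {motive : Finset (Set X) → Prop}
    (F : Finset (Set X)) (empty : motive ∅)
    (insert : ∀ (P : Set X) (G : Finset (Set X)), P ∉ G → (∀ S ∈ G, S ⊆ P → S = P) →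
      motive G → motive (insert P G)) : motive F := by
  induction F using Finset.strongInduction with
  | H F ih =>
    rcases F.eq_empty_or_nonempty with rfl | hF
    · exact empty
    · obtain ⟨P, hP⟩ := F.exists_minimal hF
      rw [← Finset.insert_erase hP.1]
      refine insert P _ (Finset.notMem_erase _ _) (fun S hS hSP => ?_)
        (ih _ (Finset.erase_ssubset hP.1))
      exact Set.Subset.antisymm hSP (hP.2 (Finset.mem_of_mem_erase hS) hSP)

/-- Only the maximal members matter, and they are disjoint. Adding minimal sets last brings this
out: each new set lies in an earlier one or is disjoint from all of them. -/
theorem IsLaminar.measure_biUnion_le {X : Type*} [MeasurableSpace X] (μ ν : Measure X)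
    (F : Finset (Set X)) (hF : IsLaminar (F : Set (Set X))) (hm : ∀ S ∈ F, MeasurableSet S)
    (h : ∀ S ∈ F, μ S ≤ ν S) : μ (⋃ S ∈ F, S) ≤ ν (⋃ S ∈ F, S) := by
  classical
  induction F using Finset.induction_on_minimal with
  | empty => simp
  | insert P G hPG hmin ih =>
    have ih := ih (hF.mono (by simp)) (fun S hS => hm S (by simp [hS]))
      (fun S hS => h S (by simp [hS]))
    simp only [Finset.set_biUnion_insert]
    by_cases hsub : ∃ S ∈ G, P ⊆ S
    · obtain ⟨S, hS, hPS⟩ := hsub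
      have hsub : P ⊆ ⋃ S ∈ G, S := fun x hx => mem_biUnion (t := fun S => S) hS (hPS hx)
      rwa [union_eq_self_of_subset_left hsub]
    · push Not at hsub
      have hdisj : Disjoint P (⋃ S ∈ G, S) := by
        simp only [disjoint_iUnion_right]
        intro S hS
        rcases hF P (by simp) S (by simp [hS]) with h1 | h1 | h1
        · exact h1
        · exact absurd h1 (hsub S hS)
        · exact absurd (hmin S hS h1 ▸ Subset.rfl) (hsub S hS)
      have hmeas : MeasurableSet P := hm P (by simp)
      rw [measure_union' hdisj hmeas, measure_union' hdisj hmeas]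
      exact add_le_add (h P (by simp)) ih

/-- A kernel of a relation that is contained in strict inclusion. -/
theorem Finset.exists_kernel {X : Type*} (F : Finset (Set X)) (D : Set X → Set X → Prop) :
    ∃ G ⊆ F, (∀ S ∈ G, ∀ R ∈ G, S ⊂ R → ¬ D S R) ∧
      ∀ P ∈ F, P ∈ G ∨ ∃ R ∈ G, P ⊂ R ∧ D P R := by
  classical
  induction F using Finset.induction_on_minimal with
  | empty => exact ⟨∅, by simp⟩
  | insert P F hPG hmin ih =>
    obtain ⟨G, hGF, h1, h2⟩ := ih
    by_cases hP : ∃ R ∈ G, P ⊂ R ∧ D P R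
    · refine ⟨G, hGF.trans (Finset.subset_insert _ _), h1, fun S hS => ?_⟩
      rcases Finset.mem_insert.1 hS with hS | hS
      · exact Or.inr (hS ▸ hP)
      · exact h2 S hS
    · refine ⟨Insert.insert P G, Finset.insert_subset_insert _ hGF, fun S hS R hR hSR hD => ?_,
        fun S hS => ?_⟩
      -- No earlier set lies strictly inside the minimal set `P`, so a new pair can only have `P` as
      -- its smaller member, and `hP` excludes this.
      · rcases Finset.mem_insert.1 hR with hR' | hR'
        · rcases Finset.mem_insert.1 hS with hS' | hS'
          · exact hSR.ne (hS'.trans hR'.symm)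
          · exact hSR.ne ((hmin S (hGF hS') (hR' ▸ hSR.subset)).trans hR'.symm)
        · rcases Finset.mem_insert.1 hS with hS' | hS'
          · exact hP ⟨R, hR', hS' ▸ hSR, hS' ▸ hD⟩
          · exact h1 S hS' R hR' hSR hD
      · rcases Finset.mem_insert.1 hS with rfl | hS
        · exact Or.inl (Finset.mem_insert_self _ _)
        · rcases h2 S hS with h | ⟨R, hR, h⟩
          · exact Or.inl (Finset.mem_insert_of_mem h)
          · exact Or.inr ⟨R, Finset.mem_insert_of_mem hR, h⟩

open Classical in
/-- If the strictly smaller members cover at most half of each member, the family is Carleson. -/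
theorem IsLaminar.sum_measure_le {X : Type*} [MeasurableSpace X] (μ : Measure X)
    (G : Finset (Set X)) (hG : IsLaminar (G : Set (Set X))) (hm : ∀ S ∈ G, MeasurableSet S)
    (hfin : ∀ S ∈ G, μ S ≠ ∞)
    (h : ∀ R ∈ G, 2 * μ (⋃ S ∈ G, ⋃ _ : S ⊂ R, S) ≤ μ R) (R : Set X) :
    ∑ S ∈ G with S ⊆ R, μ S ≤ 2 * μ R := by
  classical
  -- The part of `R` outside its strictly smaller members carries at least half of `μ R`, and
  -- laminarity makes these parts pairwise disjoint.
  set E : Set X → Set X := fun R => R \ ⋃ S ∈ G, ⋃ _ : S ⊂ R, S with hE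
  have hmU : ∀ R, MeasurableSet (⋃ S ∈ G, ⋃ _ : S ⊂ R, S) := fun R =>
    G.measurableSet_biUnion fun S hS => MeasurableSet.iUnion fun _ => hm S hS
  have hmE : ∀ R ∈ G, MeasurableSet (E R) := fun R hR => (hm R hR).diff (hmU R)
  have hle : ∀ R ∈ G, μ R ≤ 2 * μ (E R) := by
    intro R hR
    have hsub : (⋃ S ∈ G, ⋃ _ : S ⊂ R, S) ⊆ R := by
      simp only [iUnion_subset_iff]
      exact fun S _ hSR => hSR.subset
    have h1 : μ (E R) + μ (⋃ S ∈ G, ⋃ _ : S ⊂ R, S) = μ R := by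
      have := measure_sdiff_add_inter (μ := μ) R (hmU R)
      rwa [inter_eq_self_of_subset_right hsub] at this
    have h2 := h R hR
    have h3 := hfin R hR
    have h4 : μ R + μ R ≤ 2 * μ (E R) + μ R := by
      calc μ R + μ R = 2 * μ (E R) + 2 * μ (⋃ S ∈ G, ⋃ _ : S ⊂ R, S) := by
            rw [← mul_add, h1, two_mul]
        _ ≤ _ := by gcongr
    exact (ENNReal.add_le_add_iff_right h3).1 h4
  have hdisj : ((G.filter (· ⊆ R) : Finset (Set X)) : Set (Set X)).PairwiseDisjoint E := by
    intro S hS T hT hST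
    have hS' : S ∈ G := (Finset.mem_filter.1 hS).1
    have hT' : T ∈ G := (Finset.mem_filter.1 hT).1
    have key : ∀ S ∈ G, ∀ T, S ≠ T → S ⊆ T → Disjoint (E S) (E T) := by
      intro S hS T hST hsub
      refine disjoint_left.2 fun x hxS hxT => hxT.2 ?_
      simp only [mem_iUnion]
      exact ⟨S, hS, hsub.ssubset_of_ne hST, hxS.1⟩
    rcases hG S hS' T hT' with h1 | h1 | h1
    · exact h1.mono sdiff_subset sdiff_subset
    · exact key S hS' T hST h1
    · exact (key T hT' S hST.symm h1).symm
  calc ∑ S ∈ G with S ⊆ R, μ S ≤ ∑ S ∈ G with S ⊆ R, 2 * μ (E S) :=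
        Finset.sum_le_sum fun S hS => hle S (Finset.mem_filter.1 hS).1
    _ = 2 * μ (⋃ S ∈ G.filter (· ⊆ R), E S) := by
        rw [← Finset.mul_sum, measure_biUnion_finset hdisj
          fun S hS => hmE S (Finset.mem_filter.1 hS).1]
    _ ≤ 2 * μ R := by
        gcongr
        simp only [iUnion_subset_iff]
        exact fun S hS => sdiff_subset.trans (Finset.mem_filter.1 hS).2

/-! ### Sparse domination uniform in the matrix -/

/-- `∫_S |A h|`. -/
noncomputable def opInt {X : Type} [MeasurableSpace X] {n : ℕ} (μ : Measure X)
    (h : X → EuclideanSpace ℂ (Fin n)) (S : Set X)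
    (A : EuclideanSpace ℂ (Fin n) →L[ℂ] EuclideanSpace ℂ (Fin n)) : ℝ≥0∞ :=
  ∫⁻ y in S, ‖A (h y)‖ₑ ∂μ

section

variable {X : Type} [MeasurableSpace X] {n : ℕ} {μ : Measure X}
  {h : X → EuclideanSpace ℂ (Fin n)} {S R : Set X}

theorem measurable_enorm_clm (hh : Measurable h)
    (A : EuclideanSpace ℂ (Fin n) →L[ℂ] EuclideanSpace ℂ (Fin n)) :
    Measurable fun y => ‖A (h y)‖ₑ :=
  (A.continuous.measurable.comp hh).enorm

theorem opInt_ne_top (hS : ∫⁻ y in S, ‖h y‖ₑ ∂μ ≠ ∞)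
    (A : EuclideanSpace ℂ (Fin n) →L[ℂ] EuclideanSpace ℂ (Fin n)) : opInt μ h S A ≠ ∞ := by
  refine ne_top_of_le_ne_top (ENNReal.mul_ne_top (enorm_ne_top (x := A)) hS) ?_
  rw [← lintegral_const_mul' _ _ enorm_ne_top]
  exact lintegral_mono fun y => A.le_opENorm _

theorem opInt_mono (hSR : S ⊆ R)
    (A : EuclideanSpace ℂ (Fin n) →L[ℂ] EuclideanSpace ℂ (Fin n)) :
    opInt μ h S A ≤ opInt μ h R A := lintegral_mono_set hSR

theorem opInt_add_le (hh : Measurable h)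
    (A B : EuclideanSpace ℂ (Fin n) →L[ℂ] EuclideanSpace ℂ (Fin n)) :
    opInt μ h S (A + B) ≤ opInt μ h S A + opInt μ h S B := by
  unfold opInt
  rw [← lintegral_add_left (measurable_enorm_clm hh A)]
  exact lintegral_mono fun y => enorm_add_le _ _

theorem opInt_smul (c : ℝ)
    (A : EuclideanSpace ℂ (Fin n) →L[ℂ] EuclideanSpace ℂ (Fin n)) :
    opInt μ h S (c • A) = ‖c‖ₑ * opInt μ h S A := by
  unfold opInt
  rw [← lintegral_const_mul' _ _ enorm_ne_top]
  exact lintegral_congr fun y => by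
    rw [smul_apply, enorm_smul]

theorem opInt_zero : opInt μ h S 0 = 0 := by simp [opInt]

theorem opInt_sum_le (hh : Measurable h) {ι : Type*} (s : Finset ι)
    (A : ι → EuclideanSpace ℂ (Fin n) →L[ℂ] EuclideanSpace ℂ (Fin n)) :
    opInt μ h S (∑ i ∈ s, A i) ≤ ∑ i ∈ s, opInt μ h S (A i) := by
  classical
  induction s using Finset.induction_on with
  | empty => simp [opInt_zero]
  | insert i s hi ih =>
    rw [Finset.sum_insert hi, Finset.sum_insert hi]
    exact (opInt_add_le hh _ _).trans (add_le_add_right ih _)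

/-- The seminorm `A ↦ ∫_S |A h|`. -/
noncomputable def opSeminorm (hh : Measurable h) (hS : ∫⁻ y in S, ‖h y‖ₑ ∂μ ≠ ∞) :
    Seminorm ℝ (EuclideanSpace ℂ (Fin n) →L[ℂ] EuclideanSpace ℂ (Fin n)) :=
  Seminorm.of (fun A => (opInt μ h S A).toReal)
    (fun A B => by
      rw [← ENNReal.toReal_add (opInt_ne_top hS A) (opInt_ne_top hS B)]
      exact ENNReal.toReal_mono
        (ENNReal.add_ne_top.2 ⟨opInt_ne_top hS A, opInt_ne_top hS B⟩) (opInt_add_le hh A B))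
    (fun c A => by rw [opInt_smul, ENNReal.toReal_mul, toReal_enorm])

theorem opInt_eq_withDensity (hS : MeasurableSet S)
    (A : EuclideanSpace ℂ (Fin n) →L[ℂ] EuclideanSpace ℂ (Fin n)) :
    opInt μ h S A = μ.withDensity (fun y => ‖A (h y)‖ₑ) S :=
  (withDensity_apply _ hS).symm

end

open Classical in
/-- A finite laminar family has a Carleson subfamily whose members dominate all the averages
`|P|⁻¹ ∫_P |A h|`, simultaneously for all matrices `A`. -/
theorem exists_sparse (n : ℕ) : ∃ K : ℝ≥0, ∀ (X : Type) [MeasurableSpace X] (μ : Measure X)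
    (h : X → EuclideanSpace ℂ (Fin n)) (_ : Measurable h) (F : Finset (Set X))
    (_ : IsLaminar (F : Set (Set X))) (_ : ∀ P ∈ F, MeasurableSet P) (_ : ∀ P ∈ F, μ P ≠ ∞)
    (_ : ∀ P ∈ F, ∫⁻ y in P, ‖h y‖ₑ ∂μ ≠ ∞),
    ∃ G ⊆ F, (∀ R, ∑ S ∈ G with S ⊆ R, μ S ≤ 2 * μ R) ∧
      ∀ P ∈ F, ∃ R ∈ G, P ⊆ R ∧ ∀ A : EuclideanSpace ℂ (Fin n) →L[ℂ] EuclideanSpace ℂ (Fin n),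
        μ R * opInt μ h P A ≤ K * μ P * opInt μ h R A := by
  set L := EuclideanSpace ℂ (Fin n) →L[ℂ] EuclideanSpace ℂ (Fin n) with hL
  set m := Module.finrank ℝ L with hm
  obtain ⟨C, hC0, hC⟩ := Seminorm.exists_adapted_basis m
  -- Each of the `m` basis directions will cover at most a fraction `1 / K'` of `R`, and `m / (2 (m
  -- + 1)) ≤ 1 / 2`. The `+ 1` in the final constant keeps it at least `1`, so that a selected set
  -- dominates itself.
  set K' : ℝ≥0 := 2 * (m + 1) with hK'
  refine ⟨K' * m * C.toNNReal + 1, fun X _ μ h hh F hF hmeas hfin hint => ?_⟩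
  set K : ℝ≥0 := K' * m * C.toNNReal + 1 with hK
  -- A set is discarded when a larger selected set dominates its averages for all matrices.
  -- Domination is then built in, and only the packing of `G` needs proof.
  obtain ⟨G, hGF, hG1, hG2⟩ := F.exists_kernel
    (fun P R => ∀ A : L, μ R * opInt μ h P A ≤ K * μ P * opInt μ h R A)
  refine ⟨G, hGF, ?_, fun P hP => ?_⟩
  swap
  · rcases hG2 P hP with hP | ⟨R, hR, hPR, h1⟩
    · refine ⟨P, hP, Subset.rfl, fun A => ?_⟩
      rw [mul_assoc]
      refine le_mul_of_one_le_left' ?_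
      have : (1 : ℝ≥0) ≤ K := by rw [hK]; exact le_add_of_nonneg_left (zero_le)
      exact_mod_cast this
    · exact ⟨R, hR, hPR.subset, h1⟩
  refine (hF.mono (by exact_mod_cast hGF)).sum_measure_le μ G (fun S hS => hmeas S (hGF hS))
    (fun S hS => hfin S (hGF hS)) fun R hR => ?_
  have hRF := hGF hR
  obtain ⟨b, φ, hb⟩ := hC L (opSeminorm hh (hint R hRF)) rfl
  set I : Fin m → ℝ≥0∞ := fun i => opInt μ h R (b i) with hI
  -- the members that are large relative to the `i`-th basis vector
  set Gi : Fin m → Finset (Set X) := fun i =>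
    G.filter fun S => S ⊂ R ∧ K' * μ S * I i < μ R * opInt μ h S (b i) with hGi
  have hcover : (⋃ S ∈ G, ⋃ _ : S ⊂ R, S) ⊆ ⋃ i, ⋃ S ∈ Gi i, S := by
    simp only [iUnion_subset_iff]
    intro S hS hSR
    -- If no basis matrix had a large average on `S`, expanding `A` in the basis adapted to `A ↦ ∫_R
    -- |A h|` would show that `R` dominates `S`, which the kernel property forbids.
    obtain ⟨i, hi⟩ : ∃ i, K' * μ S * I i < μ R * opInt μ h S (b i) := by
      by_contra! hcon
      refine hG1 S hS R hR hSR fun A => ?_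
      have hA := hb A
      have key : ∀ i, ‖φ i A‖ₑ * I i ≤ C.toNNReal * opInt μ h R A := by
        intro i
        have h1 := hA.2 i
        have h2 := ENNReal.ofReal_le_ofReal h1
        have h3 : ∀ B, opSeminorm hh (hint R hRF) B = (opInt μ h R B).toReal := fun B => rfl
        rw [h3, h3, ENNReal.ofReal_mul (abs_nonneg _), ENNReal.ofReal_mul hC0,
          ENNReal.ofReal_toReal (opInt_ne_top (hint R hRF) _),
          ENNReal.ofReal_toReal (opInt_ne_top (hint R hRF) _)] at h2
        rw [← Real.enorm_abs, Real.enorm_of_nonneg (abs_nonneg _)]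
        exact h2
      calc μ R * opInt μ h S A
          ≤ μ R * ∑ i, ‖φ i A‖ₑ * opInt μ h S (b i) := by
            gcongr
            conv_lhs => rw [hA.1]
            refine (opInt_sum_le hh _ _).trans_eq ?_
            exact Finset.sum_congr rfl fun i _ => opInt_smul _ _
        _ = ∑ i, ‖φ i A‖ₑ * (μ R * opInt μ h S (b i)) := by
            rw [Finset.mul_sum]
            exact Finset.sum_congr rfl fun i _ => by ring
        _ ≤ ∑ i : Fin m, ‖φ i A‖ₑ * (K' * μ S * I i) :=
            Finset.sum_le_sum fun i _ => mul_le_mul' le_rfl (hcon i)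
        _ = ∑ i : Fin m, K' * μ S * (‖φ i A‖ₑ * I i) :=
            Finset.sum_congr rfl fun i _ => by ring
        _ ≤ ∑ i : Fin m, K' * μ S * (C.toNNReal * opInt μ h R A) :=
            Finset.sum_le_sum fun i _ => mul_le_mul' le_rfl (key i)
        _ = ((K' * m * C.toNNReal : ℝ≥0) : ℝ≥0∞) * μ S * opInt μ h R A := by
            simp only [Finset.sum_const, Finset.card_univ, Fintype.card_fin, nsmul_eq_mul]
            push_cast
            ring
        _ ≤ K * μ S * opInt μ h R A := by
            gcongr
            rw [hK]
            exact le_add_of_nonneg_right zero_le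
    intro x hx
    simp only [mem_iUnion]
    exact ⟨i, S, Finset.mem_filter.2 ⟨hS, hSR, hi⟩, hx⟩
  have hone : ∀ i, K' * μ (⋃ S ∈ Gi i, S) ≤ μ R := by
    intro i
    rcases (Gi i).eq_empty_or_nonempty with h0 | ⟨S₀, hS₀⟩
    · simp [h0]
    have hI0 : I i ≠ 0 := by
      intro h0
      have h1 := (Finset.mem_filter.1 hS₀).2
      have h2 : opInt μ h S₀ (b i) = 0 := le_antisymm ((opInt_mono h1.1.subset _).trans h0.le) zero_le
      rw [h2, mul_zero] at h1
      exact not_lt_zero h1.2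
    have hIt : I i ≠ ∞ := opInt_ne_top (hint R hRF) _
    have hsub : ∀ S ∈ Gi i, S ∈ F := fun S hS => hGF (Finset.mem_filter.1 hS).1
    -- The weak type (1,1) bound for one direction: each member of `Gi i` satisfies `K' I_i μ(S) ≤
    -- μ(R) ∫_S |b_i h|`, and laminarity transfers this to the union.
    have h1 := IsLaminar.measure_biUnion_le ((K' * I i) • μ)
      (μ R • μ.withDensity (fun y => ‖b i (h y)‖ₑ)) (Gi i) (hF.mono hsub)
      (fun S hS => hmeas S (hsub S hS)) (fun S hS => by
        simp only [Measure.smul_apply, smul_eq_mul]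
        rw [← opInt_eq_withDensity (hmeas S (hsub S hS))]
        refine le_of_eq_of_le (by ring) (Finset.mem_filter.1 hS).2.2.le)
    simp only [Measure.smul_apply, smul_eq_mul] at h1
    have h2 : μ.withDensity (fun y => ‖b i (h y)‖ₑ) (⋃ S ∈ Gi i, S) ≤ I i := by
      rw [hI]
      simp only
      rw [opInt_eq_withDensity (hmeas R hRF)]
      refine measure_mono ?_
      simp only [iUnion_subset_iff]
      exact fun S hS => (Finset.mem_filter.1 hS).2.1.subset
    have h3 : I i * (K' * μ (⋃ S ∈ Gi i, S)) ≤ I i * μ R := by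
      calc I i * (K' * μ (⋃ S ∈ Gi i, S)) = K' * I i * μ (⋃ S ∈ Gi i, S) := by ring
        _ ≤ μ R * I i := h1.trans (by gcongr)
        _ = I i * μ R := mul_comm _ _
    exact (ENNReal.mul_le_mul_iff_right hI0 hIt).1 h3
  have hsum : K' * μ (⋃ i, ⋃ S ∈ Gi i, S) ≤ m * μ R := by
    calc K' * μ (⋃ i, ⋃ S ∈ Gi i, S) ≤ K' * ∑ i, μ (⋃ S ∈ Gi i, S) := by
          gcongr
          exact measure_iUnion_fintype_le _ _
      _ = ∑ i, K' * μ (⋃ S ∈ Gi i, S) := Finset.mul_sum _ _ _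
      _ ≤ ∑ _i : Fin m, μ R := Finset.sum_le_sum fun i _ => hone i
      _ = m * μ R := by simp
  have hfinal : ((m + 1 : ℝ≥0) : ℝ≥0∞) * (2 * μ (⋃ S ∈ G, ⋃ _ : S ⊂ R, S)) ≤
      ((m + 1 : ℝ≥0) : ℝ≥0∞) * μ R := by
    calc ((m + 1 : ℝ≥0) : ℝ≥0∞) * (2 * μ (⋃ S ∈ G, ⋃ _ : S ⊂ R, S))
        = K' * μ (⋃ S ∈ G, ⋃ _ : S ⊂ R, S) := by rw [hK']; push_cast; ring
      _ ≤ K' * μ (⋃ i, ⋃ S ∈ Gi i, S) := by gcongr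
      _ ≤ m * μ R := hsum
      _ ≤ _ := by
        gcongr
        push_cast
        exact le_add_of_nonneg_right zero_le
  refine (ENNReal.mul_le_mul_iff_right ?_ ENNReal.coe_ne_top).1 hfinal
  exact_mod_cast (by positivity : (m + 1 : ℝ≥0) ≠ 0)

/-! ### Young functions and Hölder's inequality -/

namespace IsYoungFunction

variable {Φ : ℝ → ℝ}


theorem nonneg (hΦ : IsYoungFunction Φ) {s : ℝ} (hs : 0 ≤ s) : 0 ≤ Φ s := by
  rw [← hΦ.map_zero]
  exact hΦ.monotoneOn (mem_Ici.2 le_rfl) hs hs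

theorem le_mul (hΦ : IsYoungFunction Φ) {s : ℝ} (hs : 0 ≤ s) (hs1 : s ≤ 1) : Φ s ≤ s * Φ 1 := by
  have := hΦ.convexOn.2 (mem_Ici.2 zero_le_one) (mem_Ici.2 le_rfl) hs (sub_nonneg.2 hs1)
    (add_sub_cancel _ _)
  simpa [hΦ.map_zero] using this

theorem bddAbove (hΦ : IsYoungFunction Φ) (t : ℝ) : BddAbove (range fun s : Ioi (0 : ℝ) => (s : ℝ) * t - Φ s) := by
  obtain ⟨M, hM⟩ := (hΦ.superlinear.eventually_ge_atTop t).exists_forall_of_atTop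
  refine ⟨|M| * |t|, ?_⟩
  rintro _ ⟨⟨s, hs⟩, rfl⟩
  have hs : 0 < s := hs
  simp only
  rcases le_total M s with h | h
  · have h1 := hM s h
    rw [le_div_iff₀ hs] at h1
    have : 0 ≤ |M| * |t| := by positivity
    linarith
  · have h1 : s * t ≤ |M| * |t| :=
      (mul_le_mul_of_nonneg_left (le_abs_self t) hs.le).trans
        (mul_le_mul_of_nonneg_right (h.trans (le_abs_self M)) (abs_nonneg t))
    linarith [hΦ.nonneg hs.le]

theorem mul_sub_le (hΦ : IsYoungFunction Φ) {s : ℝ} (hs : 0 < s) (t : ℝ) : s * t - Φ s ≤ complementary Φ t :=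
  le_ciSup (hΦ.bddAbove t) (⟨s, hs⟩ : Ioi (0 : ℝ))

theorem complementary_mono (hΦ : IsYoungFunction Φ) : Monotone (complementary Φ) := by
  intro t u htu
  refine ciSup_mono (hΦ.bddAbove u) fun s => ?_
  have : (s : ℝ) * t ≤ s * u := mul_le_mul_of_nonneg_left htu (le_of_lt s.2)
  linarith

theorem complementary_nonneg (hΦ : IsYoungFunction Φ) {t : ℝ} (ht : 0 ≤ t) : 0 ≤ complementary Φ t := by
  refine le_of_forall_pos_le_add fun ε hε => ?_
  have h1 := hΦ.nonneg zero_le_one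
  set s := min 1 (ε / (Φ 1 + 1)) with hs
  have hs0 : 0 < s := lt_min one_pos (by positivity)
  have h2 := hΦ.le_mul hs0.le (min_le_left _ _)
  have h3 : s * Φ 1 ≤ ε := by
    calc s * Φ 1 ≤ ε / (Φ 1 + 1) * (Φ 1 + 1) :=
          mul_le_mul (min_le_right _ _) (by linarith) h1 (by positivity)
      _ = ε := by field_simp
  have h4 := hΦ.mul_sub_le hs0 t
  have h5 : 0 ≤ s * t := by positivity
  linarith

theorem mul_le (hΦ : IsYoungFunction Φ) {s t : ℝ} (hs : 0 ≤ s) (ht : 0 ≤ t) : s * t ≤ Φ s + complementary Φ t := by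
  rcases hs.eq_or_lt with rfl | hs
  · simpa [hΦ.map_zero] using hΦ.complementary_nonneg ht
  · linarith [hΦ.mul_sub_le hs t]

theorem complementary_mul_le (hΦ : IsYoungFunction Φ) {l : ℝ} (hl : 0 ≤ l) (hl1 : l ≤ 1) (t : ℝ) :
    complementary Φ (l * t) ≤ l * complementary Φ t := by
  refine ciSup_le fun s => ?_
  have h1 := mul_le_mul_of_nonneg_left (hΦ.mul_sub_le s.2 t) hl
  have h2 : l * Φ s ≤ Φ s := mul_le_of_le_one_left (hΦ.nonneg (le_of_lt s.2)) hl1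
  nlinarith

theorem sub_le_complementary (hΦ : IsYoungFunction Φ) (t : ℝ) : t - Φ 1 ≤ complementary Φ t := by
  simpa using hΦ.mul_sub_le one_pos t

theorem exists_complementary_le (hΦ : IsYoungFunction Φ) {ε B : ℝ} (hε : 0 < ε) :
    ∃ m : ℕ, complementary Φ (B / 2 ^ m) ≤ ε := by
  obtain ⟨m, hm⟩ := exists_pow_lt_of_lt_one (y := (1 / 2 : ℝ))
    (show 0 < ε / (|complementary Φ B| + 1) by positivity) (by norm_num)
  refine ⟨m, ?_⟩
  have h1 := hΦ.complementary_mul_le (l := (1 / 2) ^ m) (by positivity)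
    (pow_le_one₀ (by norm_num) (by norm_num)) B
  have h2 : (1 / 2 : ℝ) ^ m * B = B / 2 ^ m := by
    rw [one_div, inv_pow]; field_simp
  rw [h2] at h1
  refine h1.trans ?_
  rw [lt_div_iff₀ (by positivity)] at hm
  have h3 : (1 / 2 : ℝ) ^ m * complementary Φ B ≤ (1 / 2) ^ m * (|complementary Φ B| + 1) :=
    mul_le_mul_of_nonneg_left (by linarith [le_abs_self (complementary Φ B)]) (by positivity)
  exact h3.trans hm.le

/-- Hölder's inequality for the localized Orlicz norms of complementary functions. -/
theorem lintegral_mul_le (hΦ : IsYoungFunction Φ) {d : ℕ} {Q : Set (EuclideanSpace ℝ (Fin d))} (hQ0 : volume Q ≠ 0)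
    (hQt : volume Q ≠ ∞) (g φ : EuclideanSpace ℝ (Fin d) → ℝ) (hφ : Measurable φ)
    (hφ0 : ∀ y, 0 ≤ φ y) {τ : ℝ} (hτ : 0 < τ)
    (h : ∫⁻ y in Q, ENNReal.ofReal (complementary Φ (φ y / τ)) ≤ volume Q) :
    ∫⁻ y in Q, ENNReal.ofReal (|g y| * φ y) ≤
      2 * volume Q * ENNReal.ofReal τ * orliczNorm Φ Q g := by
  have hτ' : ENNReal.ofReal τ ≠ 0 := by simpa using hτ
  have hc0 : 2 * volume Q * ENNReal.ofReal τ ≠ 0 := mul_ne_zero (mul_ne_zero two_ne_zero hQ0) hτ'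
  have hct : 2 * volume Q * ENNReal.ofReal τ ≠ ∞ :=
    ENNReal.mul_ne_top (ENNReal.mul_ne_top (by simp) hQt) ENNReal.ofReal_ne_top
  rw [mul_comm, ← ENNReal.div_le_iff hc0 hct]
  -- Young's inequality is applied to `|g| / s` and `φ / τ` for each admissible `s`. The two terms
  -- integrate to at most `|Q|` each, whence the factor `2`. The sum of integrals splits through the
  -- measurability of the `φ` term alone, so `g` may be arbitrary.
  refine le_iInf fun s => le_iInf fun hs => le_iInf fun hadm => ?_
  rw [ENNReal.div_le_iff hc0 hct]
  have hadm' : ∫⁻ y in Q, ENNReal.ofReal (Φ (|g y| / s)) ≤ volume Q := by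
    rw [mul_comm, ← div_eq_mul_inv] at hadm
    simpa using (ENNReal.div_le_iff hQ0 hQt).1 hadm
  have hmeas : Measurable fun y => ENNReal.ofReal (complementary Φ (φ y / τ)) :=
    (hΦ.complementary_mono.measurable.comp (hφ.div_const τ)).ennreal_ofReal
  calc ∫⁻ y in Q, ENNReal.ofReal (|g y| * φ y)
      ≤ ∫⁻ y in Q, ENNReal.ofReal (s * τ) * (ENNReal.ofReal (Φ (|g y| / s)) +
          ENNReal.ofReal (complementary Φ (φ y / τ))) := by
        refine lintegral_mono fun y => ?_
        have h1 : 0 ≤ |g y| / s := by positivity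
        have h2 : 0 ≤ φ y / τ := div_nonneg (hφ0 y) hτ.le
        rw [← ENNReal.ofReal_add (hΦ.nonneg h1) (hΦ.complementary_nonneg h2),
          ← ENNReal.ofReal_mul (by positivity)]
        refine ENNReal.ofReal_le_ofReal ?_
        have h3 := mul_le_mul_of_nonneg_left (hΦ.mul_le h1 h2) (mul_pos hs hτ).le
        refine le_of_eq_of_le ?_ h3
        field_simp
    _ = ENNReal.ofReal (s * τ) * ((∫⁻ y in Q, ENNReal.ofReal (Φ (|g y| / s))) +
          ∫⁻ y in Q, ENNReal.ofReal (complementary Φ (φ y / τ))) := by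
        rw [lintegral_const_mul' _ _ ENNReal.ofReal_ne_top, lintegral_add_right _ hmeas]
    _ ≤ ENNReal.ofReal (s * τ) * (volume Q + volume Q) := by gcongr
    _ = ENNReal.ofReal s * (2 * volume Q * ENNReal.ofReal τ) := by
        rw [ENNReal.ofReal_mul hs.le]; ring

end IsYoungFunction

/-! ### The condition `B_{p,q}` in dyadic form and the sum over levels -/

/-- The function `t ↦ 1_{t > η} Ψ(t) / t ^ p`. -/
noncomputable def tailRatio (Ψ : ℝ → ℝ) (η p t : ℝ) : ℝ≥0∞ :=
  if η < t then ENNReal.ofReal (Ψ t / t ^ p) else 0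

theorem measurable_tailRatio {Ψ : ℝ → ℝ} (hΨ : Monotone Ψ) (η p : ℝ) :
    Measurable (tailRatio Ψ η p) :=
  Measurable.ite measurableSet_Ioi
    (hΨ.measurable.div (measurable_id.pow_const p)).ennreal_ofReal measurable_const

/-- By monotonicity, the value at `2^(n+1)` is at most the values on the next dyadic interval, so
each term is compared with the `B_{p,q}` integral there. The loss is `4^q` from `t^q` and `2` from
`dt / t`. -/
theorem IsYoungFunction.tsum_dyadic_lt_top {Φ : ℝ → ℝ} (hΦ : IsYoungFunction Φ) {p q : ℝ}
    (hp : 0 < p) (hq : 0 < q) (hB : InBpq p q (complementary Φ)) :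
    ∑' n : ℕ, ENNReal.ofReal (complementary Φ (2 ^ (n + 1)) ^ (q / p) / (2 ^ n) ^ q) < ∞ := by
  set Ψ := complementary Φ with hΨ
  have hs : 0 < q / p := by positivity
  set w : ℝ → ℝ≥0∞ := fun t => ENNReal.ofReal (Ψ t ^ (q / p) / t ^ q / t) with hw
  have hterm : ∀ n : ℕ, ENNReal.ofReal (Ψ (2 ^ (n + 1)) ^ (q / p) / (2 ^ n) ^ q) ≤
      ENNReal.ofReal (4 ^ q * 2) * ∫⁻ t in Ico ((2 : ℝ) ^ (n + 1)) (2 ^ (n + 2)), w t := by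
    intro n
    have h2n : (0 : ℝ) < 2 ^ n := by positivity
    have hΨ0 : 0 ≤ Ψ (2 ^ (n + 1)) := hΦ.complementary_nonneg (by positivity)
    set c : ℝ := Ψ (2 ^ (n + 1)) ^ (q / p) / (2 ^ (n + 2)) ^ q / 2 ^ (n + 2) with hc
    have hc0 : 0 ≤ c := by positivity
    have hlow : ENNReal.ofReal c * ENNReal.ofReal (2 ^ (n + 2) - 2 ^ (n + 1)) ≤
        ∫⁻ t in Ico ((2 : ℝ) ^ (n + 1)) (2 ^ (n + 2)), w t := by
      rw [← Real.volume_Ico, ← setLIntegral_const]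
      refine setLIntegral_mono' measurableSet_Ico fun t ht => ENNReal.ofReal_le_ofReal ?_
      have ht0 : 0 < t := lt_of_lt_of_le (by positivity) ht.1
      have h1 : Ψ (2 ^ (n + 1)) ^ (q / p) ≤ Ψ t ^ (q / p) :=
        Real.rpow_le_rpow hΨ0 (hΦ.complementary_mono ht.1) hs.le
      have h2 : t ^ q ≤ (2 ^ (n + 2)) ^ q := Real.rpow_le_rpow ht0.le ht.2.le hq.le
      have h3 : 0 < t ^ q := by positivity
      have h4 : t ≤ 2 ^ (n + 2) := ht.2.le
      have h5 : 0 ≤ Ψ (2 ^ (n + 1)) ^ (q / p) := by positivity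
      have h6 : 0 ≤ Ψ t ^ (q / p) := h5.trans h1
      rw [hc]
      gcongr
    refine le_trans ?_ (mul_le_mul' le_rfl hlow)
    rw [← ENNReal.ofReal_mul hc0, ← ENNReal.ofReal_mul (by positivity)]
    refine ENNReal.ofReal_le_ofReal (le_of_eq ?_)
    have e1 : ((2 : ℝ) ^ (n + 2)) ^ q = 4 ^ q * (2 ^ n) ^ q := by
      rw [← Real.mul_rpow (by norm_num) h2n.le]; congr 1; ring
    have h4q : (0 : ℝ) < 4 ^ q := by positivity
    have h2q : (0 : ℝ) < (2 ^ n) ^ q := by positivity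
    rw [hc, e1]
    field_simp
    ring
  refine lt_of_le_of_lt (ENNReal.tsum_le_tsum hterm) ?_
  rw [ENNReal.tsum_mul_left]
  refine ENNReal.mul_lt_top ENNReal.ofReal_lt_top (lt_of_le_of_lt ?_ hB)
  have hmono : Monotone fun n : ℕ => (2 : ℝ) ^ (n + 1) :=
    fun a b hab => pow_le_pow_right₀ one_le_two (by omega)
  have hdisj := hmono.pairwise_disjoint_on_Ico_succ
  simp only [Order.succ_eq_add_one] at hdisj
  rw [← lintegral_iUnion (fun _ => measurableSet_Ico) hdisj]
  refine lintegral_mono_set (iUnion_subset fun n t ht => ?_)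
  exact lt_of_lt_of_le (one_lt_pow₀ one_lt_two (by omega)) ht.1

/-- As `k` runs over `ℤ`, the numbers `u / 2^k` visit each dyadic interval at most once, so the sum
is at most the dyadic series, uniformly in `u`. The cutoff at `2^(-m)` leaves only finitely many
intervals to the left of `1`, where `B_{p,q}` says nothing. -/
theorem IsYoungFunction.exists_tsum_tailRatio_le {Φ : ℝ → ℝ} (hΦ : IsYoungFunction Φ) {p q : ℝ}
    (hp : 0 < p) (hq : 0 < q) (hB : InBpq p q (complementary Φ)) (m : ℕ) :
    ∃ D : ℝ≥0, ∀ u : ℝ, 0 ≤ u →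
      ∑' k : ℤ, tailRatio (complementary Φ) (1 / 2 ^ m) p (u / 2 ^ k) ^ (q / p) ≤ D := by
  set Ψ := complementary Φ with hΨ
  have hs : 0 < q / p := by positivity
  set δ : ℤ → ℝ≥0∞ := fun i =>
    if -(m : ℤ) ≤ i then ENNReal.ofReal (Ψ (2 ^ (i + 1)) ^ (q / p) / (2 ^ i) ^ q) else 0 with hδ
  have hδtop : ∑' i, δ i < ∞ := by
    have hinj : Function.Injective fun n : ℕ => (n : ℤ) - m := fun a b h => by
      simpa using h
    have hsupp : Function.support δ ⊆ range fun n : ℕ => (n : ℤ) - m := by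
      intro i hi
      have : -(m : ℤ) ≤ i := by
        by_contra h
        exact hi (by simp [hδ, h])
      exact ⟨(i + m).toNat, by simp only; omega⟩
    rw [← hinj.tsum_eq hsupp, ← ENNReal.summable.sum_add_tsum_nat_add' (k := m)]
    refine ENNReal.add_lt_top.2 ⟨?_, ?_⟩
    · refine ENNReal.sum_lt_top.2 fun i _ => ?_
      simp only [hδ]
      split_ifs
      · exact ENNReal.ofReal_lt_top
      · exact ENNReal.zero_lt_top
    · refine lt_of_le_of_lt (le_of_eq ?_) (hΦ.tsum_dyadic_lt_top hp hq hB)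
      refine tsum_congr fun n => ?_
      have h1 : ((n + m : ℕ) : ℤ) - m = n := by push_cast; ring
      simp only [hδ, h1]
      rw [if_pos (by omega)]
      norm_cast
  refine ⟨(∑' i, δ i).toNNReal, fun u hu => ?_⟩
  rw [ENNReal.coe_toNNReal hδtop.ne]
  rcases hu.eq_or_lt with rfl | hu
  · have h0 : ∀ k : ℤ, tailRatio Ψ (1 / 2 ^ m) p (0 / 2 ^ k) ^ (q / p) = 0 := by
      intro k
      have : ¬ (1 / 2 ^ m : ℝ) < 0 / 2 ^ k := by
        rw [zero_div, not_lt]; positivity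
      rw [tailRatio, if_neg this, ENNReal.zero_rpow_of_pos hs]
    simp only [h0, tsum_zero, zero_le]
  set i := Int.log 2 u with hi
  have hi1 : (2 : ℝ) ^ i ≤ u := by exact_mod_cast Int.zpow_log_le_self (b := 2) one_lt_two hu
  have hi2 : u < (2 : ℝ) ^ (i + 1) := by
    exact_mod_cast Int.lt_zpow_succ_log_self (b := 2) one_lt_two u
  rw [← (Equiv.subLeft i).tsum_eq δ]
  refine ENNReal.tsum_le_tsum fun k => ?_
  simp only [Equiv.subLeft_apply]
  have hk : (0 : ℝ) < 2 ^ k := by positivity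
  set t := u / 2 ^ k with ht
  have ht1 : (2 : ℝ) ^ (i - k) ≤ t := by
    rw [zpow_sub₀ two_ne_zero]; exact div_le_div_of_nonneg_right hi1 hk.le
  have ht2 : t < (2 : ℝ) ^ (i - k + 1) := by
    rw [show i - k + 1 = i + 1 - k by ring, zpow_sub₀ two_ne_zero]
    exact div_lt_div_of_pos_right hi2 hk
  have ht0 : 0 < t := by positivity
  unfold tailRatio
  split_ifs with hη
  · have hmi : -(m : ℤ) ≤ i - k := by
      have h1 : (2 : ℝ) ^ (-(m : ℤ)) < 2 ^ (i - k + 1) := by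
        rw [zpow_neg, zpow_natCast, ← one_div]; exact hη.trans ht2
      have := (zpow_lt_zpow_iff_right₀ (one_lt_two (α := ℝ))).1 h1
      omega
    have hΨt : 0 ≤ Ψ t := hΦ.complementary_nonneg ht0.le
    simp only [hδ]
    rw [if_pos hmi, ENNReal.ofReal_rpow_of_nonneg (by positivity) hs.le]
    refine ENNReal.ofReal_le_ofReal ?_
    rw [Real.div_rpow hΨt (by positivity), ← Real.rpow_mul ht0.le, mul_div_cancel₀ _ hp.ne']
    have h1 : Ψ t ≤ Ψ (2 ^ (i - k + 1)) := hΦ.complementary_mono ht2.le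
    have h2 := hΨt.trans h1
    gcongr
  · rw [ENNReal.zero_rpow_of_pos hs]; exact zero_le

theorem rpow_lintegral_le {X : Type*} [MeasurableSpace X] (ν : Measure X) {s : ℝ} (hs : 1 ≤ s)
    {ω : X → ℝ≥0∞} (hω : AEMeasurable ω ν) :
    (∫⁻ y, ω y ∂ν) ^ s ≤ ν univ ^ (s - 1) * ∫⁻ y, ω y ^ s ∂ν := by
  rcases hs.eq_or_lt with rfl | hs
  · simp
  have hs0 : 0 < s := by linarith
  have hconj := Real.HolderConjugate.conjExponent hs
  have h1 := ENNReal.lintegral_mul_le_Lp_mul_Lq ν hconj hω (aemeasurable_const (b := (1 : ℝ≥0∞)))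
  simp only [Pi.mul_apply, mul_one, ENNReal.one_rpow, lintegral_const, one_mul] at h1
  calc (∫⁻ y, ω y ∂ν) ^ s
      ≤ ((∫⁻ y, ω y ^ s ∂ν) ^ (1 / s) * ν univ ^ (1 / s.conjExponent)) ^ s := by gcongr
    _ = ν univ ^ (s - 1) * ∫⁻ y, ω y ^ s ∂ν := by
      rw [ENNReal.mul_rpow_of_nonneg _ _ hs0.le, ← ENNReal.rpow_mul, ← ENNReal.rpow_mul,
        one_div_mul_cancel hs0.ne', ENNReal.rpow_one, mul_comm]
      congr 2
      rw [Real.conjExponent]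
      have : s - 1 ≠ 0 := by linarith
      field_simp

-- Among the sets of one level only the maximal ones `R` matter: the sum of `μ(S)^s` over those
-- inside `R` is at most `μ(R)^(s-1) ∑ μ(S) ≤ 2 μ(R)^s` by the Carleson condition. For a maximal `R`
-- of level `k`, the level condition gives `2^(kp) μ(R) ≤ 2 ∫_R ω_k dν`, where `dν = φ^p dμ` and
-- `ω_k` is the tail ratio at `φ / 2^k`. After Hölder with exponent `s`, the maximal sets of a fixed
-- level are disjoint, so pointwise only `∑_k ω_k^s ≤ D` remains.
open Classical in
theorem IsLaminar.sum_level_le {X : Type} [MeasurableSpace X] (μ : Measure X) {Ψ : ℝ → ℝ}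
    (hΨ : Monotone Ψ) {η p s : ℝ} (hη : 0 < η) (hη2 : Ψ η ≤ 1 / 2) (hp : 0 < p) (hs : 1 ≤ s)
    {D : ℝ≥0} (hD : ∀ u : ℝ, 0 ≤ u → ∑' k : ℤ, tailRatio Ψ η p (u / 2 ^ k) ^ s ≤ D)
    (G : Finset (Set X)) (hG : IsLaminar (G : Set (Set X))) (hm : ∀ S ∈ G, MeasurableSet S)
    (hfin : ∀ S ∈ G, μ S ≠ ∞) (hcar : ∀ R, ∑ S ∈ G with S ⊆ R, μ S ≤ 2 * μ R)
    (φ : X → ℝ) (hφ : Measurable φ) (hφ0 : ∀ y, 0 ≤ φ y) (κ : Set X → ℤ)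
    (hκ : ∀ S ∈ G, μ S ≤ ∫⁻ y in S, ENNReal.ofReal (Ψ (φ y / 2 ^ κ S)) ∂μ) :
    ∑ S ∈ G, ENNReal.ofReal (2 ^ κ S) ^ (p * s) * μ S ^ s ≤
      2 * 2 ^ s * D * (∫⁻ y, ENNReal.ofReal (φ y) ^ p ∂μ) ^ s := by
  have hs0 : 0 < s := by linarith
  set a : ℤ → ℝ≥0∞ := fun k => ENNReal.ofReal (2 ^ k) ^ (p * s) with ha
  set M := G.filter fun R => ∀ S ∈ G, κ S = κ R → R ⊆ S → S = R with hM
  set ν := μ.withDensity fun y => ENNReal.ofReal (φ y) ^ p with hν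
  have hφp : Measurable fun y => ENNReal.ofReal (φ y) ^ p := hφ.ennreal_ofReal.pow_const p
  set N := ν univ with hN
  have hNeq : N = ∫⁻ y, ENNReal.ofReal (φ y) ^ p ∂μ := by
    rw [hN, hν, withDensity_apply _ MeasurableSet.univ, setLIntegral_univ]
  set ω : ℤ → X → ℝ≥0∞ := fun k y => tailRatio Ψ η p (φ y / 2 ^ k) with hω
  have hωm : ∀ k, Measurable (ω k) := fun k =>
    (measurable_tailRatio hΨ η p).comp (hφ.div_const _)
  -- a single set
  have hsingle : ∀ R ∈ G, a (κ R) * μ R ^ s ≤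
      2 ^ s * (N ^ (s - 1) * ∫⁻ y in R, ω (κ R) y ^ s ∂ν) := by
    intro R hR
    set k := κ R with hk
    have h2k : (0 : ℝ) < 2 ^ k := by positivity
    have hct : ENNReal.ofReal (2 ^ k) ^ p ≠ ∞ :=
      ENNReal.rpow_ne_top_of_nonneg hp.le ENNReal.ofReal_ne_top
    -- Where `φ / 2^k ≤ η`, `Ψ` is at most `1 / 2`. That part accounts for at most half of the left
    -- side and is absorbed, which is why the tail ratio may be cut off at `η`.
    have hpt : ∀ y, ENNReal.ofReal (2 ^ k) ^ p * ENNReal.ofReal (Ψ (φ y / 2 ^ k)) ≤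
        ω k y * ENNReal.ofReal (φ y) ^ p + ENNReal.ofReal (2 ^ k) ^ p * 2⁻¹ := by
      intro y
      simp only [hω, tailRatio]
      split_ifs with hlt
      · have ht0 : 0 < φ y / 2 ^ k := hη.trans hlt
        have hφy : 0 < φ y := by
          rcases (hφ0 y).eq_or_lt with h | h
          · rw [← h, zero_div] at ht0; exact absurd ht0 (lt_irrefl _)
          · exact h
        refine le_add_right (le_of_eq ?_)
        rw [ENNReal.ofReal_rpow_of_pos h2k, ENNReal.ofReal_rpow_of_pos hφy, mul_comm,
          ← ENNReal.ofReal_mul' (by positivity), ← ENNReal.ofReal_mul' (by positivity),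
          Real.div_rpow hφy.le h2k.le]
        congr 1
        field_simp
      · rw [zero_mul, zero_add]
        gcongr
        have h1 := (hΨ (not_lt.1 hlt)).trans hη2
        refine (ENNReal.ofReal_le_ofReal h1).trans (le_of_eq ?_)
        rw [one_div, ENNReal.ofReal_inv_of_pos two_pos]
        simp
    have h1 : ENNReal.ofReal (2 ^ k) ^ p * μ R ≤ 2 * ∫⁻ y in R, ω k y ∂ν := by
      have h2 : ENNReal.ofReal (2 ^ k) ^ p * μ R ≤
          (∫⁻ y in R, ω k y ∂ν) + ENNReal.ofReal (2 ^ k) ^ p * 2⁻¹ * μ R := by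
        calc ENNReal.ofReal (2 ^ k) ^ p * μ R
            ≤ ENNReal.ofReal (2 ^ k) ^ p * ∫⁻ y in R, ENNReal.ofReal (Ψ (φ y / 2 ^ k)) ∂μ :=
              mul_le_mul' le_rfl (hκ R hR)
          _ = ∫⁻ y in R, ENNReal.ofReal (2 ^ k) ^ p * ENNReal.ofReal (Ψ (φ y / 2 ^ k)) ∂μ :=
              (lintegral_const_mul' _ _ hct).symm
          _ ≤ ∫⁻ y in R, (ω k y * ENNReal.ofReal (φ y) ^ p + ENNReal.ofReal (2 ^ k) ^ p * 2⁻¹) ∂μ :=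
              lintegral_mono hpt
          _ = _ := by
              rw [lintegral_add_right _ measurable_const, setLIntegral_const, hν,
                restrict_withDensity (hm R hR), lintegral_withDensity_eq_lintegral_mul _ hφp (hωm k)]
              simp only [Pi.mul_apply, mul_comm]
      have h3 : ENNReal.ofReal (2 ^ k) ^ p * 2⁻¹ * μ R ≠ ∞ :=
        ENNReal.mul_ne_top (ENNReal.mul_ne_top hct (by simp)) (hfin R hR)
      have h4 : ENNReal.ofReal (2 ^ k) ^ p * 2⁻¹ * μ R + ENNReal.ofReal (2 ^ k) ^ p * 2⁻¹ * μ R =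
          ENNReal.ofReal (2 ^ k) ^ p * μ R := by
        rw [← add_mul, ← mul_add, ENNReal.inv_two_add_inv_two, mul_one]
      rw [← h4] at h2
      have h5 := (ENNReal.add_le_add_iff_right h3).1 h2
      calc ENNReal.ofReal (2 ^ k) ^ p * μ R
          = 2 * (ENNReal.ofReal (2 ^ k) ^ p * 2⁻¹ * μ R) := by rw [two_mul, h4]
        _ ≤ _ := by gcongr
    have h6 := rpow_lintegral_le (ν.restrict R) hs (hωm k).aemeasurable
    calc a k * μ R ^ s = (ENNReal.ofReal (2 ^ k) ^ p * μ R) ^ s := by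
          rw [ENNReal.mul_rpow_of_nonneg _ _ hs0.le, ← ENNReal.rpow_mul]
      _ ≤ (2 * ∫⁻ y in R, ω k y ∂ν) ^ s := by gcongr
      _ = 2 ^ s * (∫⁻ y in R, ω k y ∂ν) ^ s := ENNReal.mul_rpow_of_nonneg _ _ hs0.le
      _ ≤ 2 ^ s * (ν.restrict R univ ^ (s - 1) * ∫⁻ y in R, ω k y ^ s ∂ν) := by gcongr
      _ ≤ _ := by
          have : 0 ≤ s - 1 := by linarith
          gcongr
          exact Measure.restrict_apply_univ R ▸ measure_mono (subset_univ R)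
  -- every set lies in a maximal one of the same level
  have hmax : ∀ S ∈ G, ∃ R ∈ M, κ S = κ R ∧ S ⊆ R := by
    intro S hS
    obtain ⟨R, hSR, hR⟩ := (G.filter fun T => κ T = κ S ∧ S ⊆ T).exists_le_maximal
      (show S ∈ G.filter fun T => κ T = κ S ∧ S ⊆ T by simp [hS])
    have hR1 := Finset.mem_filter.1 hR.1
    refine ⟨R, Finset.mem_filter.2 ⟨hR1.1, fun T hT hTR hRT => ?_⟩, hR1.2.1.symm, hSR⟩
    have := hR.2 (Finset.mem_filter.2 ⟨hT, hTR.trans hR1.2.1, hR1.2.2.trans hRT⟩) hRT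
    exact Set.Subset.antisymm this hRT
  choose! r hrM hrκ hrS using hmax
  have hred : ∑ S ∈ G, a (κ S) * μ S ^ s ≤ ∑ R ∈ M, 2 * (a (κ R) * μ R ^ s) := by
    rw [← Finset.sum_fiberwise_of_maps_to hrM]
    refine Finset.sum_le_sum fun R hR => ?_
    calc ∑ S ∈ G with r S = R, a (κ S) * μ S ^ s
        ≤ ∑ S ∈ G with r S = R, a (κ R) * μ R ^ (s - 1) * μ S := by
          refine Finset.sum_le_sum fun S hS => ?_
          obtain ⟨hSG, rfl⟩ := Finset.mem_filter.1 hS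
          rw [hrκ S hSG, mul_assoc]
          refine mul_le_mul' le_rfl ?_
          have h1 : μ S ^ s = μ S ^ (s - 1) * μ S := by
            conv_rhs => rw [← ENNReal.rpow_one (μ S), ← ENNReal.rpow_mul, one_mul]
            rw [← ENNReal.rpow_add_of_nonneg _ _ (by linarith) zero_le_one, sub_add_cancel]
          rw [h1]
          have : 0 ≤ s - 1 := by linarith
          gcongr
          exact hrS S hSG
      _ = a (κ R) * μ R ^ (s - 1) * ∑ S ∈ G with r S = R, μ S := (Finset.mul_sum _ _ _).symm
      _ ≤ a (κ R) * μ R ^ (s - 1) * ∑ S ∈ G with S ⊆ R, μ S := by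
          gcongr with S hS
          intro hSR
          exact hSR ▸ hrS S hS
      _ ≤ a (κ R) * μ R ^ (s - 1) * (2 * μ R) := mul_le_mul' le_rfl (hcar R)
      _ = 2 * (a (κ R) * μ R ^ s) := by
          have h1 : μ R ^ s = μ R ^ (s - 1) * μ R := by
            conv_rhs => rw [← ENNReal.rpow_one (μ R), ← ENNReal.rpow_mul, one_mul]
            rw [← ENNReal.rpow_add_of_nonneg _ _ (by linarith) zero_le_one, sub_add_cancel]
          rw [h1]; ring
  have hpack : ∑ R ∈ M, ∫⁻ y in R, ω (κ R) y ^ s ∂ν ≤ D * N := by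
    have hMG : ∀ R ∈ M, R ∈ G := fun R hR => (Finset.mem_filter.1 hR).1
    have h1 : ∀ R ∈ M, ∫⁻ y in R, ω (κ R) y ^ s ∂ν =
        ∫⁻ y, R.indicator (fun y => ω (κ R) y ^ s) y ∂ν := fun R hR =>
      (lintegral_indicator (hm R (hMG R hR)) _).symm
    rw [Finset.sum_congr rfl h1, ← lintegral_finsetSum _ fun R hR =>
      ((hωm (κ R)).pow_const s).indicator (hm R (hMG R hR)), hN, ← lintegral_const]
    refine lintegral_mono fun y => ?_
    refine le_trans ?_ (hD (φ y) (hφ0 y))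
    -- Two maximal sets of the same level that both contain `y` are nested, hence equal.
    have hinj : Set.InjOn κ (M.filter (y ∈ ·) : Finset (Set X)) := by
      intro R hR T hT hRT
      have hR' := Finset.mem_filter.1 (Finset.mem_coe.1 hR)
      have hT' := Finset.mem_filter.1 (Finset.mem_coe.1 hT)
      have hR'' := Finset.mem_filter.1 hR'.1
      have hT'' := Finset.mem_filter.1 hT'.1
      rcases hG R hR''.1 T hT''.1 with h | h | h
      · exact absurd hT'.2 (disjoint_left.1 h hR'.2)
      · exact (hR''.2 T hT''.1 hRT.symm h).symm
      · exact hT''.2 R hR''.1 hRT h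
    calc ∑ R ∈ M, R.indicator (fun y => ω (κ R) y ^ s) y
        = ∑ R ∈ M with y ∈ R, ω (κ R) y ^ s := by
          refine Eq.trans ?_ (Finset.sum_filter (s := M) (y ∈ ·) _).symm
          exact Finset.sum_congr rfl fun R _ => Set.indicator_apply _ _ _
      _ = ∑ k ∈ (M.filter (y ∈ ·)).image κ, ω k y ^ s :=
          (Finset.sum_image (f := fun k => ω k y ^ s) hinj).symm
      _ ≤ ∑' k : ℤ, ω k y ^ s := ENNReal.sum_le_tsum _
  calc ∑ S ∈ G, a (κ S) * μ S ^ s ≤ ∑ R ∈ M, 2 * (a (κ R) * μ R ^ s) := hred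
    _ ≤ ∑ R ∈ M, 2 * (2 ^ s * (N ^ (s - 1) * ∫⁻ y in R, ω (κ R) y ^ s ∂ν)) :=
        Finset.sum_le_sum fun R hR =>
          mul_le_mul' le_rfl (hsingle R (Finset.mem_filter.1 hR).1)
    _ = 2 * 2 ^ s * N ^ (s - 1) * ∑ R ∈ M, ∫⁻ y in R, ω (κ R) y ^ s ∂ν := by
        rw [Finset.mul_sum]
        exact Finset.sum_congr rfl fun R _ => by ring
    _ ≤ 2 * 2 ^ s * N ^ (s - 1) * (D * N) := mul_le_mul' le_rfl hpack
    _ = 2 * 2 ^ s * D * N ^ s := by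
        have h1 : N ^ s = N ^ (s - 1) * N := by
          conv_rhs => rw [← ENNReal.rpow_one N, ← ENNReal.rpow_mul, one_mul]
          rw [← ENNReal.rpow_add_of_nonneg _ _ (by linarith) zero_le_one, sub_add_cancel]
        rw [h1]; ring
    _ = _ := by rw [hNeq]

/-- This is Fatou's lemma. Continuity can fail, since `h` need not be integrable on `S`. -/
theorem lowerSemicontinuous_opInt {X : Type} [MeasurableSpace X] {n : ℕ} {μ : Measure X}
    {h : X → EuclideanSpace ℂ (Fin n)} (hh : Measurable h) (S : Set X) :
    LowerSemicontinuous (opInt μ h S) := by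
  rw [lowerSemicontinuous_iff_le_liminf]
  intro A
  refine le_trans (lintegral_mono fun y => ?_) (lintegral_liminf_le fun B => measurable_enorm_clm hh B)
  have hc : Continuous fun B : EuclideanSpace ℂ (Fin n) →L[ℂ] EuclideanSpace ℂ (Fin n) =>
      ‖B (h y)‖ₑ := by fun_prop
  exact (hc.tendsto A).liminf_eq.ge

/-- Here `2^k` is, within a factor of two, the Luxemburg size of `φ` on `S` for the complementary
function: `k + 1` is the least exponent at which the integral drops to `μ S`. Boundedness of `φ`
provides such an exponent. If `φ` is not null on `S`, the linear growth of the complementary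
function bounds these exponents below. -/
theorem IsYoungFunction.exists_level {Φ : ℝ → ℝ} (hΦ : IsYoungFunction Φ) {X : Type}
    [MeasurableSpace X] (μ : Measure X) {S : Set X} (hSt : μ S ≠ ∞) {φ : X → ℝ}
    (hφ : Measurable φ) (hφ0 : ∀ y, 0 ≤ φ y) {B : ℝ} (hB : ∀ y, φ y ≤ B)
    (hne : ¬ ∀ᵐ y ∂μ.restrict S, φ y = 0) :
    ∃ k : ℤ, μ S ≤ ∫⁻ y in S, ENNReal.ofReal (complementary Φ (φ y / 2 ^ k)) ∂μ ∧
      ∫⁻ y in S, ENNReal.ofReal (complementary Φ (φ y / 2 ^ (k + 1))) ∂μ ≤ μ S := by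
  set H : ℤ → ℝ≥0∞ := fun k => ∫⁻ y in S, ENNReal.ofReal (complementary Φ (φ y / 2 ^ k)) ∂μ
    with hH
  have hanti : Antitone H := by
    intro k l hkl
    refine lintegral_mono fun y => ENNReal.ofReal_le_ofReal (hΦ.complementary_mono ?_)
    exact div_le_div_of_nonneg_left (hφ0 y) (by positivity)
      (zpow_le_zpow_right₀ one_le_two hkl)
  have hup : ∃ k, H k ≤ μ S := by
    obtain ⟨m, hm⟩ := hΦ.exists_complementary_le (B := B) one_pos
    refine ⟨m, ?_⟩
    calc H m ≤ ∫⁻ _ in S, 1 ∂μ := by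
          refine lintegral_mono fun y => ?_
          rw [← ENNReal.ofReal_one]
          refine ENNReal.ofReal_le_ofReal (le_trans (hΦ.complementary_mono ?_) hm)
          rw [zpow_natCast]
          exact div_le_div_of_nonneg_right (hB y) (by positivity)
      _ = μ S := by simp
  have hlow : ∃ k, μ S < H k := by
    obtain ⟨N, hN⟩ : ∃ N : ℕ, μ.restrict S {y | (1 / (N + 1) : ℝ) ≤ φ y} ≠ 0 := by
      by_contra! hcon
      refine hne ?_
      have : ∀ᵐ y ∂μ.restrict S, ∀ N : ℕ, φ y < 1 / (N + 1) := by
        rw [ae_all_iff]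
        intro N
        rw [ae_iff]
        simpa only [not_lt] using hcon N
      filter_upwards [this] with y hy
      refine le_antisymm (le_of_forall_pos_le_add fun ε hε => ?_) (hφ0 y)
      obtain ⟨N, hN⟩ := exists_nat_one_div_lt hε
      linarith [hy N]
    set T := {y | (1 / (N + 1) : ℝ) ≤ φ y} with hT
    have hTm : MeasurableSet T := hφ measurableSet_Ici
    have hlim : Tendsto (fun j : ℕ => ENNReal.ofReal (1 / (N + 1) * 2 ^ j - Φ 1) *
        μ.restrict S T) atTop (𝓝 ∞) := by
      have h1 : Tendsto (fun j : ℕ => (1 / (N + 1) : ℝ) * 2 ^ j - Φ 1) atTop atTop :=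
        tendsto_atTop_add_const_right _ _
          ((tendsto_pow_atTop_atTop_of_one_lt one_lt_two).const_mul_atTop (by positivity))
      have h2 := ENNReal.Tendsto.mul_const (b := μ.restrict S T)
        (ENNReal.tendsto_ofReal_atTop.comp h1) (Or.inl ENNReal.top_ne_zero)
      rwa [ENNReal.top_mul hN] at h2
    obtain ⟨j, hj⟩ := (hlim.eventually (lt_mem_nhds (lt_top_iff_ne_top.2 hSt))).exists
    refine ⟨-(j : ℤ), hj.trans_le ?_⟩
    calc ENNReal.ofReal (1 / (N + 1) * 2 ^ j - Φ 1) * μ.restrict S T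
        = ∫⁻ _ in T, ENNReal.ofReal (1 / (N + 1) * 2 ^ j - Φ 1) ∂(μ.restrict S) :=
          (setLIntegral_const _ _).symm
      _ ≤ ∫⁻ y in T, ENNReal.ofReal (complementary Φ (φ y / 2 ^ (-(j : ℤ)))) ∂(μ.restrict S) := by
          refine setLIntegral_mono' hTm fun y hy => ENNReal.ofReal_le_ofReal ?_
          refine le_trans ?_ (hΦ.sub_le_complementary _)
          rw [zpow_neg, div_inv_eq_mul, zpow_natCast]
          have : (1 / (N + 1) : ℝ) ≤ φ y := hy
          gcongr
      _ ≤ _ := setLIntegral_le_lintegral _ _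
  obtain ⟨k₀, hk₀⟩ := hlow
  obtain ⟨k, hk, hmin⟩ := Int.exists_least_of_bdd (P := fun k => H k ≤ μ S)
    ⟨k₀, fun k hk => by
      by_contra! hlt
      exact absurd (hk₀.trans_le (hanti hlt.le)) (not_lt.2 hk)⟩ hup
  refine ⟨k - 1, ?_, by rw [sub_add_cancel]; exact hk⟩
  by_contra! hlt
  have := hmin (k - 1) hlt.le
  omega

/-! ### The maximal function over a laminar family -/

/-- `x ↦ sup_{P ∋ x} |P| ^ (a - 1) ∫_P |A(x) h|`, the supremum over the members of a family. -/
noncomputable def familyMax {X : Type} [MeasurableSpace X] {n : ℕ} (μ : Measure X) (a : ℝ)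
    (h : X → EuclideanSpace ℂ (Fin n))
    (A : X → EuclideanSpace ℂ (Fin n) →L[ℂ] EuclideanSpace ℂ (Fin n)) (F : Set (Set X))
    (x : X) : ℝ≥0∞ :=
  ⨆ P ∈ F, P.indicator (fun x => μ P ^ (a - 1) * opInt μ h P (A x)) x

theorem measurable_familyMax {X : Type} [MeasurableSpace X] {n : ℕ} (μ : Measure X) (a : ℝ)
    {h : X → EuclideanSpace ℂ (Fin n)} (hh : Measurable h)
    {A : X → EuclideanSpace ℂ (Fin n) →L[ℂ] EuclideanSpace ℂ (Fin n)} (hA : Measurable A)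
    {F : Set (Set X)} (hF : F.Countable) (hm : ∀ P ∈ F, MeasurableSet P) :
    Measurable (familyMax μ a h A F) :=
  Measurable.biSup F hF fun P hP =>
    (((lowerSemicontinuous_opInt hh P).measurable.comp hA).const_mul _).indicator (hm P hP)

-- The supremum is replaced by a sum over the sparse family, Hölder is applied on each sparse set at
-- its own level `2^(κ R)`, and the hypothesis on `K` turns the `q`-th power into `2^(q κ R)
-- |R|^(q/p)`, which `IsLaminar.sum_level_le` sums. Passing from `P` to a larger `R` is harmless for
-- the fractional factor because `a ≥ 0`.
open Classical in
theorem IsYoungFunction.lintegral_familyMax_finset_le (n : ℕ) {Φ : ℝ → ℝ} (hΦ : IsYoungFunction Φ)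
    {p q : ℝ} (hp : 1 < p) (hpq : p ≤ q) (hB : InBpq p q (complementary Φ)) :
    ∃ C : ℝ≥0, ∀ {d : ℕ} (F : Finset (Set (EuclideanSpace ℝ (Fin d))))
      (_ : IsLaminar (F : Set (Set (EuclideanSpace ℝ (Fin d))))) (_ : ∀ P ∈ F, MeasurableSet P)
      (_ : ∀ P ∈ F, volume P ≠ 0) (_ : ∀ P ∈ F, volume P ≠ ∞)
      (h : EuclideanSpace ℝ (Fin d) → EuclideanSpace ℂ (Fin n)) (_ : Measurable h)
      (φ : EuclideanSpace ℝ (Fin d) → ℝ) (_ : Measurable φ) (_ : ∀ y, 0 ≤ φ y)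
      (B : ℝ≥0) (_ : ∀ y, φ y ≤ B) (_ : ∀ y, ‖h y‖ₑ ≤ B)
      (A : EuclideanSpace ℝ (Fin d) → EuclideanSpace ℂ (Fin n) →L[ℂ] EuclideanSpace ℂ (Fin n))
      (_ : Measurable A)
      (g : EuclideanSpace ℝ (Fin d) → EuclideanSpace ℝ (Fin d) → ℝ)
      (_ : ∀ᵐ x, ∀ᵐ y, ‖A x (h y)‖ ≤ |g x y| * φ y) (a : ℝ) (_ : 0 ≤ a) (K : ℝ≥0∞)
      (_ : ∀ S ∈ F, ∫⁻ x in S, orliczNorm Φ S (g x) ^ q ≤ K ^ q * volume S ^ (q / p - q * a)),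
      ∫⁻ x, familyMax volume a h A F x ^ q ≤
        C * K ^ q * (∫⁻ y, ENNReal.ofReal (φ y) ^ p) ^ (q / p) := by
  have hp0 : 0 < p := by linarith
  have hq0 : 0 < q := by linarith
  have hs1 : 1 ≤ q / p := by rwa [le_div_iff₀ hp0, one_mul]
  obtain ⟨Ks, hKs⟩ := exists_sparse n
  obtain ⟨m, hm⟩ := hΦ.exists_complementary_le (ε := 1 / 2) (B := 1) (by norm_num)
  obtain ⟨D, hD⟩ := hΦ.exists_tsum_tailRatio_le hp0 hq0 hB m
  refine ⟨(4 * Ks) ^ q * (2 * 2 ^ (q / p) * D), ?_⟩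
  intro d F hF hmeas hv0 hvt h hh φ hφ hφ0 B hφB hhB A hA g hAg a ha K hK
  obtain ⟨G, hGF, hcar, hdom⟩ := hKs _ volume h hh F hF hmeas hvt (fun P hP => by
    refine ne_top_of_le_ne_top (ENNReal.mul_ne_top (ENNReal.coe_ne_top (r := B)) (hvt P hP)) ?_
    rw [← setLIntegral_const]
    exact lintegral_mono fun y => hhB y)
  set I : Set (EuclideanSpace ℝ (Fin d)) → EuclideanSpace ℝ (Fin d) → ℝ≥0∞ := fun P x =>
    volume P ^ (a - 1) * opInt volume h P (A x) with hI
  have hImeas : ∀ P, Measurable (I P) := fun P =>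
    ((lowerSemicontinuous_opInt hh P).measurable.comp hA).const_mul _
  -- reduction to the sparse subfamily
  have hsup : ∀ x, familyMax volume a h A F x ^ q ≤
      ∑ R ∈ G, R.indicator (fun x => (Ks * I R x) ^ q) x := by
    intro x
    have h1 : familyMax volume a h A F x ≤
        (∑ R ∈ G, R.indicator (fun x => (Ks * I R x) ^ q) x) ^ (1 / q) := by
      refine iSup₂_le fun P hP => ?_
      by_cases hx : x ∈ P
      swap
      · rw [indicator_of_notMem hx]; exact zero_le
      rw [indicator_of_mem hx]
      obtain ⟨R, hR, hPR, hdomR⟩ := hdom P hP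
      have hR' := hGF hR
      have h2 : volume P ^ (a - 1) * opInt volume h P (A x) ≤ Ks * I R x := by
        have e1 : ∀ S ∈ F, volume S ^ (a - 1) = volume S ^ a * (volume S)⁻¹ := fun S hS => by
          rw [ENNReal.rpow_sub _ _ (hv0 S hS) (hvt S hS), ENNReal.rpow_one, div_eq_mul_inv]
        have h3 : (volume P)⁻¹ * opInt volume h P (A x) ≤
            Ks * ((volume R)⁻¹ * opInt volume h R (A x)) := by
          calc (volume P)⁻¹ * opInt volume h P (A x)
              = (volume P)⁻¹ * ((volume R)⁻¹ * (volume R * opInt volume h P (A x))) := by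
                rw [← mul_assoc (volume R)⁻¹, ENNReal.inv_mul_cancel (hv0 R hR') (hvt R hR'),
                  one_mul]
            _ ≤ (volume P)⁻¹ * ((volume R)⁻¹ * (Ks * volume P * opInt volume h R (A x))) :=
                 mul_le_mul' le_rfl (mul_le_mul' le_rfl (hdomR (A x)))
            _ = (volume P)⁻¹ * volume P * (Ks * ((volume R)⁻¹ * opInt volume h R (A x))) := by
                ring
            _ = _ := by rw [ENNReal.inv_mul_cancel (hv0 P hP) (hvt P hP), one_mul]
        calc volume P ^ (a - 1) * opInt volume h P (A x)
            = volume P ^ a * ((volume P)⁻¹ * opInt volume h P (A x)) := by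
              rw [e1 P hP, mul_assoc]
          _ ≤ volume R ^ a * (Ks * ((volume R)⁻¹ * opInt volume h R (A x))) := by
              gcongr
          _ = Ks * I R x := by
              simp only [hI]
              rw [e1 R hR']
              ring
      refine h2.trans ?_
      rw [← ENNReal.rpow_le_rpow_iff hq0, ← ENNReal.rpow_mul, one_div_mul_cancel hq0.ne',
        ENNReal.rpow_one]
      refine le_trans (le_of_eq ?_)
        (Finset.single_le_sum (f := fun R => R.indicator (fun x => (Ks * I R x) ^ q) x)
          (fun _ _ => zero_le) hR)
      rw [indicator_of_mem (hPR hx)]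
    calc _ ≤ ((∑ R ∈ G, R.indicator (fun x => (Ks * I R x) ^ q) x) ^ (1 / q)) ^ q := by gcongr
      _ = _ := by rw [← ENNReal.rpow_mul, one_div_mul_cancel hq0.ne', ENNReal.rpow_one]
  -- A set on which `φ` vanishes almost everywhere has no level; it contributes nothing.
  set G' := G.filter fun S => ¬ ∀ᵐ y ∂volume.restrict S, φ y = 0 with hG'
  have hlev : ∀ S ∈ G', ∃ k : ℤ, volume S ≤
      ∫⁻ y in S, ENNReal.ofReal (complementary Φ (φ y / 2 ^ k)) ∧
      ∫⁻ y in S, ENNReal.ofReal (complementary Φ (φ y / 2 ^ (k + 1))) ≤ volume S := fun S hS =>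
    have hS' := Finset.mem_filter.1 hS
    hΦ.exists_level volume (hvt S (hGF hS'.1)) hφ hφ0 hφB hS'.2
  choose! κ hκ1 hκ2 using hlev
  have hG'F : G' ⊆ F := (Finset.filter_subset _ _).trans hGF
  have hsum := IsLaminar.sum_level_le volume hΦ.complementary_mono (η := 1 / 2 ^ m)
    (by positivity) hm hp0 hs1 hD G' (hF.mono (by exact_mod_cast hG'F))
    (fun S hS => hmeas S (hG'F hS)) (fun S hS => hvt S (hG'F hS))
    (fun R => le_trans (Finset.sum_le_sum_of_subset
      (Finset.filter_subset_filter _ (Finset.filter_subset _ _))) (hcar R)) φ hφ hφ0 κ hκ1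
  have hAg' : ∀ᵐ x, ∀ R, opInt volume h R (A x) ≤ ∫⁻ y in R, ENNReal.ofReal (|g x y| * φ y) := by
    filter_upwards [hAg] with x hx R
    refine lintegral_mono_ae (ae_restrict_of_ae ?_)
    filter_upwards [hx] with y hy
    rw [← ofReal_norm]
    exact ENNReal.ofReal_le_ofReal hy
  have hterm : ∀ R ∈ G', ∫⁻ x in R, (Ks * I R x) ^ q ≤
      (4 * Ks : ℝ≥0) ^ q * K ^ q *
        (ENNReal.ofReal (2 ^ κ R) ^ (p * (q / p)) * volume R ^ (q / p)) := by
    intro R hR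
    have hRF := hG'F hR
    have h0 := hv0 R hRF
    have ht := hvt R hRF
    -- The `4` is the `2` of Hölder's inequality times the `2` from `2^(κ R + 1)`.
    set c : ℝ≥0∞ := (4 * Ks : ℝ≥0) * ENNReal.ofReal (2 ^ κ R) * volume R ^ a with hc
    have hct : c ≠ ∞ := ENNReal.mul_ne_top (ENNReal.mul_ne_top ENNReal.coe_ne_top
      ENNReal.ofReal_ne_top) (ENNReal.rpow_ne_top_of_nonneg ha ht)
    have h1 : ∀ᵐ x, Ks * I R x ≤ c * orliczNorm Φ R (g x) := by
      filter_upwards [hAg'] with x hx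
      have h2 := (hx R).trans (hΦ.lintegral_mul_le h0 ht (g x) φ hφ hφ0
        (show (0 : ℝ) < 2 ^ (κ R + 1) by positivity) (hκ2 R hR))
      have h3 : ENNReal.ofReal (2 ^ (κ R + 1)) = 2 * ENNReal.ofReal (2 ^ κ R) := by
        rw [zpow_add_one₀ two_ne_zero, mul_comm, ENNReal.ofReal_mul zero_le_two]
        simp
      have h4 : volume R ^ (a - 1) * volume R = volume R ^ a := by
        conv_lhs => rw [← ENNReal.rpow_one (volume R), ← ENNReal.rpow_mul, one_mul]
        rw [← ENNReal.rpow_add _ _ h0 ht, sub_add_cancel]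
      calc Ks * I R x ≤ Ks * (volume R ^ (a - 1) *
            (2 * volume R * ENNReal.ofReal (2 ^ (κ R + 1)) * orliczNorm Φ R (g x))) := by
            simp only [hI]; gcongr
        _ = 4 * Ks * ENNReal.ofReal (2 ^ κ R) * (volume R ^ (a - 1) * volume R) *
            orliczNorm Φ R (g x) := by rw [h3]; ring
        _ = c * orliczNorm Φ R (g x) := by rw [h4, hc]; push_cast; rfl
    calc ∫⁻ x in R, (Ks * I R x) ^ q ≤ ∫⁻ x in R, (c * orliczNorm Φ R (g x)) ^ q := by
          refine lintegral_mono_ae (ae_restrict_of_ae ?_)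
          filter_upwards [h1] with x hx
          gcongr
      _ = c ^ q * ∫⁻ x in R, orliczNorm Φ R (g x) ^ q := by
          rw [← lintegral_const_mul' _ _ (ENNReal.rpow_ne_top_of_nonneg hq0.le hct)]
          exact lintegral_congr fun x => ENNReal.mul_rpow_of_nonneg _ _ hq0.le
      _ ≤ c ^ q * (K ^ q * volume R ^ (q / p - q * a)) := mul_le_mul' le_rfl (hK R hRF)
      _ = _ := by
          have h5 : (volume R ^ a) ^ q * volume R ^ (q / p - q * a) = volume R ^ (q / p) := by
            rw [← ENNReal.rpow_mul, ← ENNReal.rpow_add _ _ h0 ht]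
            congr 1; ring
          rw [hc, ENNReal.mul_rpow_of_nonneg _ _ hq0.le, ENNReal.mul_rpow_of_nonneg _ _ hq0.le,
            mul_div_cancel₀ _ hp0.ne', ← h5]
          ring
  have hzero : ∀ R ∈ G, R ∉ G' → ∫⁻ x in R, (Ks * I R x) ^ q = 0 := by
    intro R hR hR'
    have hφR : ∀ᵐ y ∂volume.restrict R, φ y = 0 := by
      by_contra hcon
      exact hR' (Finset.mem_filter.2 ⟨hR, hcon⟩)
    rw [lintegral_eq_zero_iff (((hImeas R).const_mul _).pow_const q)]
    refine ae_restrict_of_ae ?_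
    filter_upwards [hAg'] with x hx
    have h1 : ∫⁻ y in R, ENNReal.ofReal (|g x y| * φ y) = 0 := by
      rw [← lintegral_zero (μ := volume.restrict R)]
      refine lintegral_congr_ae ?_
      filter_upwards [hφR] with y hy
      simp [hy]
    have h2 : opInt volume h R (A x) = 0 := le_antisymm ((hx R).trans h1.le) zero_le
    simp [hI, h2, hq0]
  calc ∫⁻ x, familyMax volume a h A F x ^ q
      ≤ ∫⁻ x, ∑ R ∈ G, R.indicator (fun x => (Ks * I R x) ^ q) x := lintegral_mono hsup
    _ = ∑ R ∈ G, ∫⁻ x in R, (Ks * I R x) ^ q := by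
        rw [lintegral_finsetSum _ fun R hR =>
          (((hImeas R).const_mul _).pow_const q).indicator (hmeas R (hGF hR))]
        exact Finset.sum_congr rfl fun R hR => lintegral_indicator (hmeas R (hGF hR)) _
    _ = ∑ R ∈ G', ∫⁻ x in R, (Ks * I R x) ^ q :=
        (Finset.sum_subset (Finset.filter_subset _ _) hzero).symm
    _ ≤ ∑ R ∈ G', (4 * Ks : ℝ≥0) ^ q * K ^ q *
        (ENNReal.ofReal (2 ^ κ R) ^ (p * (q / p)) * volume R ^ (q / p)) := Finset.sum_le_sum hterm
    _ = (4 * Ks : ℝ≥0) ^ q * K ^ q *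
        ∑ R ∈ G', ENNReal.ofReal (2 ^ κ R) ^ (p * (q / p)) * volume R ^ (q / p) :=
        (Finset.mul_sum _ _ _).symm
    _ ≤ (4 * Ks : ℝ≥0) ^ q * K ^ q * (2 * 2 ^ (q / p) * D *
        (∫⁻ y, ENNReal.ofReal (φ y) ^ p) ^ (q / p)) := mul_le_mul' le_rfl hsum
    _ = _ := by
        have h6 : (((4 * Ks) ^ q * (2 * 2 ^ (q / p) * D) : ℝ≥0) : ℝ≥0∞) =
            ((4 * Ks : ℝ≥0) : ℝ≥0∞) ^ q * (2 * 2 ^ (q / p) * D) := by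
          rw [ENNReal.coe_mul, ENNReal.coe_rpow_of_nonneg _ hq0.le,
            ENNReal.coe_mul (2 * 2 ^ (q / p)) D, ENNReal.coe_mul 2 (2 ^ (q / p)),
            ENNReal.coe_rpow_of_nonneg _ (by linarith)]
          rfl
        rw [h6]; ring

/-- Monotone convergence: an enumeration is cut to its first members, and `h` and `φ` are cut to the
same set where both are bounded. This preserves the pointwise bound and leaves the constant
unchanged. -/
theorem IsYoungFunction.lintegral_familyMax_le (n : ℕ) {Φ : ℝ → ℝ} (hΦ : IsYoungFunction Φ)
    {p q : ℝ} (hp : 1 < p) (hpq : p ≤ q) (hB : InBpq p q (complementary Φ)) :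
    ∃ C : ℝ≥0, ∀ {d : ℕ} (F : Set (Set (EuclideanSpace ℝ (Fin d)))) (_ : F.Countable)
      (_ : IsLaminar F) (_ : ∀ P ∈ F, MeasurableSet P)
      (_ : ∀ P ∈ F, volume P ≠ 0) (_ : ∀ P ∈ F, volume P ≠ ∞)
      (h : EuclideanSpace ℝ (Fin d) → EuclideanSpace ℂ (Fin n)) (_ : Measurable h)
      (φ : EuclideanSpace ℝ (Fin d) → ℝ) (_ : Measurable φ) (_ : ∀ y, 0 ≤ φ y)
      (A : EuclideanSpace ℝ (Fin d) → EuclideanSpace ℂ (Fin n) →L[ℂ] EuclideanSpace ℂ (Fin n))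
      (_ : Measurable A)
      (g : EuclideanSpace ℝ (Fin d) → EuclideanSpace ℝ (Fin d) → ℝ)
      (_ : ∀ᵐ x, ∀ᵐ y, ‖A x (h y)‖ ≤ |g x y| * φ y) (a : ℝ) (_ : 0 ≤ a) (K : ℝ≥0∞)
      (_ : ∀ S ∈ F, ∫⁻ x in S, orliczNorm Φ S (g x) ^ q ≤ K ^ q * volume S ^ (q / p - q * a)),
      ∫⁻ x, familyMax volume a h A F x ^ q ≤
        C * K ^ q * (∫⁻ y, ENNReal.ofReal (φ y) ^ p) ^ (q / p) := by
  classical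
  have hp0 : 0 < p := by linarith
  have hq0 : 0 < q := by linarith
  obtain ⟨C, hC⟩ := hΦ.lintegral_familyMax_finset_le n hp hpq hB
  refine ⟨C, ?_⟩
  intro d F hFc hF hmeas hv0 hvt h hh φ hφ hφ0 A hA g hAg a ha K hK
  rcases F.eq_empty_or_nonempty with rfl | hne
  · simp [familyMax, hq0]
  obtain ⟨e, rfl⟩ := hFc.exists_eq_range hne
  set E : ℕ → Set (EuclideanSpace ℝ (Fin d)) := fun k => {y | ‖h y‖ ≤ k ∧ φ y ≤ k} with hE
  have hEm : ∀ k, MeasurableSet (E k) := fun k =>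
    (measurableSet_le hh.norm measurable_const).inter (measurableSet_le hφ measurable_const)
  have hEmono : Monotone E := fun k l hkl y hy =>
    have : (k : ℝ) ≤ l := by exact_mod_cast hkl
    ⟨hy.1.trans this, hy.2.trans this⟩
  set hk : ℕ → EuclideanSpace ℝ (Fin d) → EuclideanSpace ℂ (Fin n) := fun k =>
    (E k).indicator h with hhk
  have hhkm : ∀ k, Measurable (hk k) := fun k => hh.indicator (hEm k)
  set Fk : ℕ → Finset (Set (EuclideanSpace ℝ (Fin d))) := fun k =>
    (Finset.range (k + 1)).image e with hFk
  have hFkF : ∀ k, ∀ P ∈ Fk k, P ∈ range e := by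
    intro k P hP
    obtain ⟨i, _, rfl⟩ := Finset.mem_image.1 hP
    exact mem_range_self i
  set M : ℕ → EuclideanSpace ℝ (Fin d) → ℝ≥0∞ := fun k =>
    familyMax volume a (hk k) A (Fk k) with hM
  have hMm : ∀ k, Measurable (M k) := fun k =>
    measurable_familyMax volume a (hhkm k) hA (Fk k).countable_toSet
      fun P hP => hmeas P (hFkF k P hP)
  have hopmono : ∀ P B, Monotone fun k => opInt volume (hk k) P B := by
    intro P B k l hkl
    refine lintegral_mono fun y => ?_
    simp only [hhk]
    by_cases hy : y ∈ E k
    · rw [indicator_of_mem hy, indicator_of_mem (hEmono hkl hy)]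
    · rw [indicator_of_notMem hy]; simp
  have hopsup : ∀ P B, opInt volume h P B = ⨆ k, opInt volume (hk k) P B := by
    intro P B
    unfold opInt
    rw [← lintegral_iSup (fun k => measurable_enorm_clm (hhkm k) B)]
    · refine lintegral_congr fun y => le_antisymm ?_ (iSup_le fun k => ?_)
      · obtain ⟨k, hk1⟩ := exists_nat_ge (max ‖h y‖ (φ y))
        refine le_iSup_of_le k ?_
        have : y ∈ E k := ⟨(le_max_left _ _).trans hk1, (le_max_right _ _).trans hk1⟩
        simp only [hhk]
        rw [indicator_of_mem this]
      · simp only [hhk]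
        by_cases hy : y ∈ E k
        · rw [indicator_of_mem hy]
        · rw [indicator_of_notMem hy]; simp
    · intro k l hkl y
      simp only [hhk]
      by_cases hy : y ∈ E k
      · rw [indicator_of_mem hy, indicator_of_mem (hEmono hkl hy)]
      · rw [indicator_of_notMem hy]; simp
  have hMmono : Monotone M := by
    intro k l hkl x
    refine iSup₂_le fun P hP => ?_
    have hPl : P ∈ (Fk l : Set (Set (EuclideanSpace ℝ (Fin d)))) := by
      obtain ⟨i, hi, rfl⟩ := Finset.mem_image.1 (Finset.mem_coe.1 hP)
      refine Finset.mem_coe.2 (Finset.mem_image_of_mem e ?_)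
      rw [Finset.mem_range] at hi ⊢
      omega
    refine le_trans ?_ (le_iSup₂ (f := fun P _ => P.indicator
      (fun x => volume P ^ (a - 1) * opInt volume (hk l) P (A x)) x) P hPl)
    refine indicator_le_indicator ?_
    gcongr
    exact hopmono P (A x) hkl
  have hMsup : ∀ x, familyMax volume a h A (range e) x ≤ ⨆ k, M k x := by
    intro x
    refine iSup₂_le fun P hP => ?_
    by_cases hx : x ∈ P
    swap
    · rw [indicator_of_notMem hx]; exact zero_le
    rw [indicator_of_mem hx, hopsup, ENNReal.mul_iSup]
    obtain ⟨i, rfl⟩ := hP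
    refine iSup_le fun k => le_iSup_of_le (max i k) ?_
    have hPl : e i ∈ (Fk (max i k) : Set (Set (EuclideanSpace ℝ (Fin d)))) := by
      refine Finset.mem_coe.2 (Finset.mem_image_of_mem e ?_)
      rw [Finset.mem_range]
      omega
    refine le_trans ?_ (le_iSup₂ (f := fun P _ => P.indicator
      (fun x => volume P ^ (a - 1) * opInt volume (hk (max i k)) P (A x)) x) (e i) hPl)
    rw [indicator_of_mem hx]
    gcongr
    exact hopmono _ (A x) (le_max_right i k)
  have hbound : ∀ k, ∫⁻ x, M k x ^ q ≤
      C * K ^ q * (∫⁻ y, ENNReal.ofReal (φ y) ^ p) ^ (q / p) := by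
    intro k
    have h1 := hC (Fk k) (hF.mono (hFkF k)) (fun P hP => hmeas P (hFkF k P hP))
      (fun P hP => hv0 P (hFkF k P hP)) (fun P hP => hvt P (hFkF k P hP)) (hk k) (hhkm k)
      ((E k).indicator φ) (hφ.indicator (hEm k))
      (fun y => indicator_nonneg (fun y _ => hφ0 y) y) k
      (fun y => by
        by_cases hy : y ∈ E k
        · rw [indicator_of_mem hy]; exact_mod_cast hy.2
        · rw [indicator_of_notMem hy]; positivity)
      (fun y => by
        simp only [hhk]
        by_cases hy : y ∈ E k
        · rw [indicator_of_mem hy, ← ofReal_norm]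
          refine (ENNReal.ofReal_le_ofReal hy.1).trans ?_
          simp
        · rw [indicator_of_notMem hy]; simp) A hA g
      (by
        filter_upwards [hAg] with x hx
        filter_upwards [hx] with y hy
        simp only [hhk]
        by_cases hyE : y ∈ E k
        · rwa [indicator_of_mem hyE, indicator_of_mem hyE]
        · rw [indicator_of_notMem hyE, indicator_of_notMem hyE]; simp)
      a ha K (fun S hS => hK S (hFkF k S hS))
    refine h1.trans ?_
    gcongr with y
    exact indicator_le_self' (fun y _ => hφ0 y) y
  calc ∫⁻ x, familyMax volume a h A (range e) x ^ q
      ≤ ∫⁻ x, ⨆ k, M k x ^ q := by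
        refine lintegral_mono fun x => ?_
        refine (ENNReal.rpow_le_rpow (hMsup x) hq0.le).trans_eq ?_
        exact (ENNReal.orderIsoRpow q hq0).map_iSup _
    _ = ⨆ k, ∫⁻ x, M k x ^ q :=
        lintegral_iSup (fun k => (hMm k).pow_const q)
          (fun k l hkl x => ENNReal.rpow_le_rpow (hMmono hkl x) hq0.le)
    _ ≤ _ := iSup_le hbound

/-! ### Shifted dyadic grids and the one-third trick -/

/-- The shift of the `k`-th generation of the grid with index `t`. -/
noncomputable def gridShift (t : Bool) (k : ℤ) : ℝ := if t then (-1) ^ k / 3 else 0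

/-- The half-open cube of side length `2 ^ (-k)` with index `m` in the dyadic grid with index `t`. -/
def gridCube {d : ℕ} (t : Fin d → Bool) (k : ℤ) (m : Fin d → ℤ) :
    Set (EuclideanSpace ℝ (Fin d)) :=
  {y | ∀ i, ⌊2 ^ k * y i - gridShift (t i) k⌋ = m i}

theorem floor_eq_floor_of_two_mul {v w : ℝ} (h : ⌊2 * v⌋ = ⌊2 * w⌋) : ⌊v⌋ = ⌊w⌋ := by
  have key : ∀ (j : ℤ) (v : ℝ), j ≤ ⌊v⌋ ↔ 2 * j ≤ ⌊2 * v⌋ := by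
    intro j v
    rw [Int.le_floor, Int.le_floor]
    push_cast
    constructor <;> intro h <;> linarith
  refine le_antisymm ?_ ?_
  · rw [key, ← h, ← key]
  · rw [key, h, ← key]

/-- Consecutive generations nest because `2 (-1)^k / 3 - (-1)^(k+1) / 3 = (-1)^k` is an integer;
this is the reason for the alternating sign. -/
theorem gridShift_step (t : Bool) (k : ℤ) :
    ∃ c : ℤ, 2 * gridShift t k - gridShift t (k + 1) = c := by
  rcases Int.even_or_odd k with hk | hk <;> cases t
  · exact ⟨0, by simp [gridShift]⟩
  · exact ⟨1, by simp [gridShift, zpow_add_one₀, hk.neg_one_zpow]; norm_num⟩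
  · exact ⟨0, by simp [gridShift]⟩
  · exact ⟨-1, by simp [gridShift, zpow_add_one₀, hk.neg_one_zpow]; norm_num⟩

theorem grid_floor_eq (t : Bool) {k l : ℤ} (hkl : k ≤ l) {y z : ℝ}
    (h : ⌊2 ^ l * y - gridShift t l⌋ = ⌊2 ^ l * z - gridShift t l⌋) :
    ⌊2 ^ k * y - gridShift t k⌋ = ⌊2 ^ k * z - gridShift t k⌋ := by
  induction l, hkl using Int.leInduction with
  | base => exact h
  | succ l _ ih =>
    refine ih (floor_eq_floor_of_two_mul ?_)
    obtain ⟨c, hc⟩ := gridShift_step t l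
    have e : ∀ y : ℝ, 2 ^ (l + 1) * y - gridShift t (l + 1) =
        2 * (2 ^ l * y - gridShift t l) + c := by
      intro y
      rw [← hc, zpow_add_one₀ two_ne_zero]
      ring
    rw [e, e, Int.floor_add_intCast, Int.floor_add_intCast] at h
    exact add_right_cancel h

/-- The dyadic grid with index `t`. -/
def grid {d : ℕ} (t : Fin d → Bool) : Set (Set (EuclideanSpace ℝ (Fin d))) :=
  range fun x : ℤ × (Fin d → ℤ) => gridCube t x.1 x.2

theorem countable_grid {d : ℕ} (t : Fin d → Bool) : (grid t).Countable := countable_range _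

theorem isLaminar_grid {d : ℕ} (t : Fin d → Bool) : IsLaminar (grid t) := by
  have key : ∀ k l (m m' : Fin d → ℤ), k ≤ l →
      Disjoint (gridCube t l m') (gridCube t k m) ∨ gridCube t l m' ⊆ gridCube t k m := by
    intro k l m m' hkl
    by_cases h : ∃ y, y ∈ gridCube t l m' ∧ y ∈ gridCube t k m
    · obtain ⟨y, hy1, hy2⟩ := h
      refine Or.inr fun z hz i => ?_
      rw [← hy2 i]
      exact grid_floor_eq (t i) hkl ((hz i).trans (hy1 i).symm)
    · exact Or.inl (disjoint_left.2 fun y hy1 hy2 => h ⟨y, hy1, hy2⟩)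
  rintro _ ⟨⟨k, m⟩, rfl⟩ _ ⟨⟨l, m'⟩, rfl⟩
  rcases le_total k l with hkl | hkl
  · rcases key k l m m' hkl with h | h
    · exact Or.inl h.symm
    · exact Or.inr (Or.inr h)
  · rcases key l k m' m hkl with h | h
    · exact Or.inl h
    · exact Or.inr (Or.inl h)

theorem measurableSet_of_mem_grid {d : ℕ} {t : Fin d → Bool} {P : Set (EuclideanSpace ℝ (Fin d))}
    (hP : P ∈ grid t) : MeasurableSet P := by
  obtain ⟨⟨k, m⟩, rfl⟩ := hP
  simp only [gridCube, ofPred_forall]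
  refine MeasurableSet.iInter fun i => ?_
  have : Measurable fun y : EuclideanSpace ℝ (Fin d) => ⌊2 ^ k * y i - gridShift (t i) k⌋ := by
    refine Int.measurable_floor.comp ?_
    fun_prop
  exact this (measurableSet_singleton (m i))

/-- The one-third trick in one variable. -/
theorem exists_floor_eq (k : ℤ) (a : ℝ) : ∃ (t : Bool) (m : ℤ),
    ∀ z, |z - a| < 1 / 6 → ⌊z - gridShift t k⌋ = m := by
  have h1 := Int.floor_le a
  have h2 := Int.lt_floor_add_one a
  by_cases h : (1 / 6 : ℝ) ≤ a - ⌊a⌋ ∧ a - ⌊a⌋ ≤ 5 / 6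
  · refine ⟨false, ⌊a⌋, fun z hz => ?_⟩
    rw [abs_lt] at hz
    simp only [gridShift, Bool.false_eq_true, if_false, sub_zero]
    rw [Int.floor_eq_iff]
    constructor <;> linarith
  · obtain ⟨j, hj1, hj2⟩ : ∃ j : ℤ, a - j ≤ 1 / 6 ∧ (j : ℝ) - a ≤ 1 / 6 := by
      rw [not_and_or, not_le, not_le] at h
      rcases h with h | h
      · exact ⟨⌊a⌋, by linarith, by linarith⟩
      · exact ⟨⌊a⌋ + 1, by push_cast; linarith, by push_cast; linarith⟩
    -- Now `a` is within `1 / 6` of the integer `j`, so `z` is within `1 / 3` of it; a shift by `1 /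
    -- 3` in either direction moves the whole interval to one side of `j`.
    rcases Int.even_or_odd k with hk | hk
    · refine ⟨true, j - 1, fun z hz => ?_⟩
      rw [abs_lt] at hz
      simp only [gridShift, if_true, hk.neg_one_zpow]
      rw [Int.floor_eq_iff]
      push_cast
      constructor <;> linarith
    · refine ⟨true, j, fun z hz => ?_⟩
      rw [abs_lt] at hz
      simp only [gridShift, if_true, hk.neg_one_zpow]
      rw [Int.floor_eq_iff]
      constructor <;> linarith

/-- Every cube lies in a cube of one of the grids of comparable size. -/
theorem exists_grid_cube {d : ℕ} (c : EuclideanSpace ℝ (Fin d)) {r : ℝ} (hr : 0 < r) :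
    ∃ t : Fin d → Bool, ∃ P ∈ grid t, cube c r ⊆ P ∧ P ⊆ cube c (12 * r) := by
  -- The side `2^(-k)` lies in `[6r, 12r)`: the lower bound makes the one-third trick apply, and the
  -- upper one puts the grid cube, which contains `c`, inside `cube c (12 * r)`.
  obtain ⟨k, hk1, hk2⟩ : ∃ k : ℤ, 2 ^ k * r ≤ 1 / 6 ∧ 1 < 2 ^ k * (12 * r) := by
    have hpos : 0 < 1 / (6 * r) := by positivity
    refine ⟨Int.log 2 (1 / (6 * r)), ?_, ?_⟩
    · have h1 : (2 : ℝ) ^ Int.log 2 (1 / (6 * r)) ≤ 1 / (6 * r) := by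
        exact_mod_cast Int.zpow_log_le_self (b := 2) one_lt_two hpos
      rw [le_div_iff₀ (by positivity)] at h1
      linarith
    · have h1 : 1 / (6 * r) < (2 : ℝ) ^ (Int.log 2 (1 / (6 * r)) + 1) := by
        exact_mod_cast Int.lt_zpow_succ_log_self (b := 2) one_lt_two (1 / (6 * r))
      rw [div_lt_iff₀ (by positivity), zpow_add_one₀ two_ne_zero] at h1
      linarith
  have h2k : (0 : ℝ) < 2 ^ k := by positivity
  choose t m htm using fun i => exists_floor_eq k (2 ^ k * c i)
  have hsub : cube c r ⊆ gridCube t k m := by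
    intro y hy i
    refine htm i _ ?_
    rw [← mul_sub, abs_mul, abs_of_pos h2k]
    exact (mul_lt_mul_of_pos_left (hy i) h2k).trans_le hk1
  refine ⟨t, gridCube t k m, ⟨(k, m), rfl⟩, hsub, fun y hy i => ?_⟩
  have hc : c ∈ gridCube t k m := hsub fun i => by simpa using hr
  have h1 := Int.abs_sub_lt_one_of_floor_eq_floor ((hy i).trans (hc i).symm)
  rw [sub_sub_sub_cancel_right, ← mul_sub, abs_mul, abs_of_pos h2k] at h1
  exact lt_of_mul_lt_mul_left (h1.trans hk2) h2k.le

/-! ### Volumes of cubes and comparison of Orlicz norms -/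

theorem volume_cube {d : ℕ} (c : EuclideanSpace ℝ (Fin d)) (r : ℝ) :
    volume (cube c r) = ENNReal.ofReal (2 * r) ^ d := by
  have h1 := (EuclideanSpace.volume_preserving_symm_measurableEquiv_toLp (Fin d)).measure_preimage
    (s := Set.pi univ fun i => Ioo (c i - r) (c i + r))
    (MeasurableSet.univ_pi fun i => measurableSet_Ioo).nullMeasurableSet
  have h2 : (⇑(MeasurableEquiv.toLp 2 (Fin d → ℝ)).symm ⁻¹'
      Set.pi univ fun i => Ioo (c i - r) (c i + r)) = cube c r := by
    ext y
    simp only [mem_preimage, mem_univ_pi, mem_Ioo, cube, mem_ofPred_eq]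
    refine forall_congr' fun i => ?_
    rw [abs_sub_lt_iff]
    change c i - r < y i ∧ y i < c i + r ↔ _
    constructor <;> rintro ⟨h1, h2⟩ <;> constructor <;> linarith
  rw [h2] at h1
  rw [h1, Real.volume_pi_Ioo]
  simp only [add_sub_sub_cancel, Finset.prod_const, Finset.card_univ, Fintype.card_fin]
  rw [two_mul]

theorem volume_cube_ne_zero {d : ℕ} (c : EuclideanSpace ℝ (Fin d)) {r : ℝ} (hr : 0 < r) :
    volume (cube c r) ≠ 0 := by
  rw [volume_cube]
  exact pow_ne_zero _ (by simpa using hr)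

theorem volume_cube_ne_top {d : ℕ} (c : EuclideanSpace ℝ (Fin d)) (r : ℝ) :
    volume (cube c r) ≠ ∞ := by
  rw [volume_cube]
  exact ENNReal.pow_ne_top ENNReal.ofReal_ne_top

theorem volume_cube_mul {d : ℕ} (c : EuclideanSpace ℝ (Fin d)) (r : ℝ) :
    volume (cube c (12 * r)) = 12 ^ d * volume (cube c r) := by
  rw [volume_cube, volume_cube, ← mul_pow, mul_left_comm, ENNReal.ofReal_mul (by norm_num)]
  simp

theorem isOpen_cube {d : ℕ} (c : EuclideanSpace ℝ (Fin d)) (r : ℝ) : IsOpen (cube c r) := by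
  simp only [cube, ofPred_forall]
  exact isOpen_iInter_of_finite fun i => isOpen_lt (by fun_prop) continuous_const

/-- Passing to a subset of comparable measure changes Orlicz norms by a bounded factor. -/
theorem IsYoungFunction.orliczNorm_le_mul {Φ : ℝ → ℝ} (hΦ : IsYoungFunction Φ) {d : ℕ}
    {P Q : Set (EuclideanSpace ℝ (Fin d))} (hPQ : P ⊆ Q) (hP0 : volume P ≠ 0)
    (hQt : volume Q ≠ ∞) {b : ℝ} (hb : 1 ≤ b) (hle : volume Q ≤ ENNReal.ofReal b * volume P)
    (g : EuclideanSpace ℝ (Fin d) → ℝ) :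
    orliczNorm Φ P g ≤ ENNReal.ofReal b * orliczNorm Φ Q g := by
  have hb0 : 0 < b := by linarith
  have hbE : ENNReal.ofReal b ≠ 0 := by simpa using hb0
  have hQ0 : volume Q ≠ 0 := fun h => hP0 (measure_mono_null hPQ h)
  have hPt : volume P ≠ ∞ := measure_ne_top_of_subset hPQ hQt
  rw [mul_comm, ← ENNReal.div_le_iff hbE ENNReal.ofReal_ne_top]
  refine le_iInf fun s => le_iInf fun hs => le_iInf fun hadm => ?_
  rw [ENNReal.div_le_iff hbE ENNReal.ofReal_ne_top, ← ENNReal.ofReal_mul hs.le]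
  refine iInf_le_of_le (s * b) (iInf_le_of_le (by positivity) (iInf_le_of_le ?_ le_rfl))
  rw [mul_comm, ← div_eq_mul_inv, ENNReal.div_le_iff hQ0 hQt, one_mul] at hadm
  rw [mul_comm, ← div_eq_mul_inv, ENNReal.div_le_iff hP0 hPt, one_mul]
  have h1 : ∀ y, ENNReal.ofReal b * ENNReal.ofReal (Φ (|g y| / (s * b))) ≤
      ENNReal.ofReal (Φ (|g y| / s)) := by
    intro y
    rw [← ENNReal.ofReal_mul hb0.le]
    refine ENNReal.ofReal_le_ofReal ?_
    -- Convexity and `Φ 0 = 0` give `Φ(t / b) ≤ Φ(t) / b`, which offsets the ratio of the measures.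
    have h2 := hΦ.convexOn.2 (show |g y| / s ∈ Ici 0 from mem_Ici.2 (by positivity))
      (mem_Ici.2 le_rfl) (show 0 ≤ 1 / b by positivity)
      (sub_nonneg.2 ((div_le_one hb0).2 hb)) (add_sub_cancel _ _)
    simp only [smul_eq_mul, mul_zero, add_zero, hΦ.map_zero] at h2
    have h3 : 1 / b * (|g y| / s) = |g y| / (s * b) := by field_simp
    rw [h3] at h2
    calc b * Φ (|g y| / (s * b)) ≤ b * (1 / b * Φ (|g y| / s)) :=
          mul_le_mul_of_nonneg_left h2 hb0.le
      _ = _ := by field_simp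
  have h4 : ENNReal.ofReal b * ∫⁻ y in P, ENNReal.ofReal (Φ (|g y| / (s * b))) ≤
      ENNReal.ofReal b * volume P := by
    rw [← lintegral_const_mul' _ _ ENNReal.ofReal_ne_top]
    exact (lintegral_mono h1).trans ((lintegral_mono_set hPQ).trans (hadm.trans hle))
  exact (ENNReal.mul_le_mul_iff_right hbE ENNReal.ofReal_ne_top).1 h4

/-! ### Measurability -/

theorem tendsto_cfc {n : ℕ} {A : Matrix (Fin n) (Fin n) ℂ} (hA : A.IsHermitian)
    {f : ℕ → ℝ → ℝ} {g : ℝ → ℝ}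
    (hf : ∀ i, Tendsto (fun k => f k (hA.eigenvalues i)) atTop (𝓝 (g (hA.eigenvalues i)))) :
    Tendsto (fun k => cfc (f k) A) atTop (𝓝 (cfc g A)) := by
  simp only [hA.cfc_eq, Matrix.IsHermitian.cfc, Unitary.conjStarAlgAut_apply]
  have hc : Continuous fun D : Fin n → ℂ =>
      (hA.eigenvectorUnitary : Matrix (Fin n) (Fin n) ℂ) * Matrix.diagonal D *
        star (hA.eigenvectorUnitary : Matrix (Fin n) (Fin n) ℂ) := by fun_prop
  refine (hc.tendsto _).comp (tendsto_pi_nhds.2 fun i => ?_)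
  exact (Complex.continuous_ofReal.tendsto _).comp (hf i)

theorem continuous_matCLM {n : ℕ} : Continuous (matCLM (n := n)) :=
  LinearMap.continuous_of_finiteDimensional
    (Matrix.toEuclideanCLM (n := Fin n) (𝕜 := ℂ)).toAlgEquiv.toLinearMap

theorem aemeasurable_matCLM {X : Type*} [MeasurableSpace X] {μ : Measure X} {n : ℕ}
    {W : X → Matrix (Fin n) (Fin n) ℂ} (hW : ∀ i j, AEMeasurable (fun x => W x i j) μ) :
    AEMeasurable (fun x => matCLM (W x)) μ := by
  have h1 : ∀ A : Matrix (Fin n) (Fin n) ℂ,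
      matCLM A = ∑ i, ∑ j, A i j • matCLM (Matrix.single i j 1) := by
    intro A
    conv_lhs => rw [Matrix.matrix_eq_sum_single A]
    simp only [matCLM, map_sum]
    refine Finset.sum_congr rfl fun i _ => Finset.sum_congr rfl fun j _ => ?_
    rw [← map_smul, Matrix.smul_single, smul_eq_mul, mul_one]
  simp only [fun x => h1 (W x)]
  exact Finset.aemeasurable_fun_sum _ fun i _ => Finset.aemeasurable_fun_sum _ fun j _ =>
    (hW i j).smul_const _

/-- On `[1/(k+1), k+1]` the power is approximated by polynomials. A polynomial in `W` is measurable,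
and at almost every point all eigenvalues are positive and eventually lie in these intervals. -/
theorem IsMatrixWeight.aemeasurable_matPow {d n : ℕ}
    {W : EuclideanSpace ℝ (Fin d) → Matrix (Fin n) (Fin n) ℂ} (hW : IsMatrixWeight W) (r : ℝ) :
    AEMeasurable fun x => matCLM (matPow (W x) r) := by
  have hex : ∀ k : ℕ, ∃ P : Polynomial ℝ, ∀ t ∈ Icc (1 / ((k : ℝ) + 1)) (k + 1),
      |P.eval t - t ^ r| < 1 / ((k : ℝ) + 1) := fun k => by
    refine exists_polynomial_near_of_continuousOn _ _ _ (fun t ht => ?_) _ (by positivity)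
    have : 0 < t := lt_of_lt_of_le (by positivity) ht.1
    exact (Real.continuousAt_rpow_const t r (Or.inl this.ne')).continuousWithinAt
  choose P hP using hex
  have hlim : ∀ t : ℝ, 0 < t → Tendsto (fun k => (P k).eval t) atTop (𝓝 (t ^ r)) := by
    intro t ht
    rw [tendsto_iff_dist_tendsto_zero]
    refine squeeze_zero' (Eventually.of_forall fun k => dist_nonneg) ?_
      (tendsto_one_div_add_atTop_nhds_zero_nat (𝕜 := ℝ))
    have h1 : ∀ᶠ k : ℕ in atTop, 1 / ((k : ℝ) + 1) < t :=
      (tendsto_one_div_add_atTop_nhds_zero_nat (𝕜 := ℝ)).eventually (gt_mem_nhds ht)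
    filter_upwards [h1, eventually_ge_atTop ⌈t⌉₊] with k hk1 hk2
    have hk3 : t ≤ k := (Nat.le_ceil t).trans (by exact_mod_cast hk2)
    exact (hP k t ⟨hk1.le, by linarith⟩).le
  refine aemeasurable_of_tendsto_metrizable_ae atTop
    (f := fun k x => matCLM (cfc (P k).eval (W x))) (fun k => ?_) ?_
  · have h1 : ∀ x, matCLM (cfc (P k).eval (W x)) =
        Polynomial.aeval (matCLM (W x)) (P k) := by
      intro x
      rw [cfc_polynomial (P k) (W x) (show IsSelfAdjoint (W x) from hW.selfAdjoint x)]
      exact (Polynomial.aeval_algHom_apply ((Matrix.toEuclideanCLM (n := Fin n)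
        (𝕜 := ℂ)).toAlgEquiv.toAlgHom.restrictScalars ℝ) (W x) (P k)).symm
    simp only [h1]
    have hc : Continuous fun B : EuclideanSpace ℂ (Fin n) →L[ℂ] EuclideanSpace ℂ (Fin n) =>
        Polynomial.aeval B (P k) := by
      exact (P k).continuous_aeval
    exact hc.measurable.comp_aemeasurable (aemeasurable_matCLM fun i j =>
      (hW.locallyIntegrable i j).aestronglyMeasurable.aemeasurable)
  · filter_upwards [hW.posDef] with x hx
    refine (continuous_matCLM.tendsto _).comp (tendsto_cfc (hW.selfAdjoint x) fun i => ?_)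
    exact hlim _ (hx.eigenvalues_pos i)

theorem matCLM_mul_apply {n : ℕ} (A B : Matrix (Fin n) (Fin n) ℂ) (v : EuclideanSpace ℂ (Fin n)) :
    matCLM (A * B) v = matCLM A (matCLM B v) := by
  unfold matCLM
  rw [map_mul]
  rfl

theorem lowerSemicontinuous_iSup_mem {Y E : Type*} [TopologicalSpace Y] [TopologicalSpace E]
    {U : Set Y} (hU : IsOpen U) {J : E → ℝ≥0∞} (hJ : LowerSemicontinuous J) :
    LowerSemicontinuous fun z : Y × E => ⨆ (_ : z.1 ∈ U), J z.2 := by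
  rw [lowerSemicontinuous_iff_isOpen_preimage]
  intro a
  have : (fun z : Y × E => ⨆ (_ : z.1 ∈ U), J z.2) ⁻¹' Ioi a = U ×ˢ (J ⁻¹' Ioi a) := by
    ext z
    rw [mem_preimage, mem_Ioi, lt_iSup_iff, mem_prod, exists_prop]
    rfl
  rw [this]
  exact hU.prod (hJ.isOpen_preimage a)

/-- A supremum over all cubes that contain the point, of lower semicontinuous functions of a
parameter, is a measurable function of the point. -/
theorem aemeasurable_iSup_cube {d : ℕ} {E : Type} [TopologicalSpace E] [MeasurableSpace E]
    [BorelSpace E] [SecondCountableTopology E]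
    (J : EuclideanSpace ℝ (Fin d) → ℝ → E → ℝ≥0∞) (hJ : ∀ c r, LowerSemicontinuous (J c r))
    {A : EuclideanSpace ℝ (Fin d) → E} (hA : AEMeasurable A) :
    AEMeasurable fun x => ⨆ (c : EuclideanSpace ℝ (Fin d)) (r : ℝ) (_ : 0 < r)
      (_ : x ∈ cube c r), J c r (A x) := by
  -- The supremum is uncountable, so it is handled topologically: openness of the cubes makes each
  -- term lower semicontinuous in the pair of point and parameter, and this survives any supremum.
  have hlsc : LowerSemicontinuous fun z : EuclideanSpace ℝ (Fin d) × E =>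
      ⨆ (c : EuclideanSpace ℝ (Fin d)) (r : ℝ) (_ : 0 < r) (_ : z.1 ∈ cube c r), J c r z.2 :=
    lowerSemicontinuous_iSup fun c => lowerSemicontinuous_iSup fun r =>
      lowerSemicontinuous_iSup fun _ => lowerSemicontinuous_iSup_mem (isOpen_cube c r) (hJ c r)
  have hm := hlsc.measurable
  have hp : AEMeasurable fun x : EuclideanSpace ℝ (Fin d) => (x, A x) :=
    aemeasurable_id.prodMk hA
  have h := hm.comp_aemeasurable hp
  simp only [Function.comp_def] at h
  exact h

theorem lowerSemicontinuous_const_mul_opInt {X : Type} [MeasurableSpace X] {n : ℕ} {μ : Measure X}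
    {h : X → EuclideanSpace ℂ (Fin n)} (hh : Measurable h) (S : Set X) {w : ℝ≥0∞} (hw : w ≠ ∞) :
    LowerSemicontinuous fun B => w * opInt μ h S B :=
  (ENNReal.continuous_const_mul hw).comp_lowerSemicontinuous
    (lowerSemicontinuous_opInt hh S) (fun _ _ hab => mul_le_mul' le_rfl hab)

theorem secondCountableTopology_clm (n : ℕ) :
    SecondCountableTopology (EuclideanSpace ℂ (Fin n) →L[ℂ] EuclideanSpace ℂ (Fin n)) := by
  have : ProperSpace (EuclideanSpace ℂ (Fin n) →L[ℂ] EuclideanSpace ℂ (Fin n)) :=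
    FiniteDimensional.proper ℂ _
  infer_instance

/-! ### Sorting cubes by size relative to the critical radius -/

/-- The cubes of a dyadic grid that are comparable to a cube `Q` with
`2 ^ j ≤ 1 + l_Q / ρ(x_Q) < 2 ^ (j + 1)`. -/
def levelGrid {d : ℕ} (ρ : EuclideanSpace ℝ (Fin d) → ℝ) (j : ℕ) (t : Fin d → Bool) :
    Set (Set (EuclideanSpace ℝ (Fin d))) :=
  {P ∈ grid t | ∃ c r, 0 < r ∧ cube c r ⊆ P ∧ P ⊆ cube c (12 * r) ∧
    2 ^ j ≤ 1 + 2 * r / ρ c ∧ 1 + 2 * r / ρ c < 2 ^ (j + 1)}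

theorem levelGrid_subset_grid {d : ℕ} (ρ : EuclideanSpace ℝ (Fin d) → ℝ) (j : ℕ)
    (t : Fin d → Bool) : levelGrid ρ j t ⊆ grid t := fun _ hP => hP.1

theorem volume_ne_zero_of_mem_levelGrid {d : ℕ} {ρ : EuclideanSpace ℝ (Fin d) → ℝ} {j : ℕ}
    {t : Fin d → Bool} {P : Set (EuclideanSpace ℝ (Fin d))} (hP : P ∈ levelGrid ρ j t) :
    volume P ≠ 0 := by
  obtain ⟨_, c, r, hr, h1, _⟩ := hP
  exact fun h => volume_cube_ne_zero c hr (measure_mono_null h1 h)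

theorem volume_ne_top_of_mem_levelGrid {d : ℕ} {ρ : EuclideanSpace ℝ (Fin d) → ℝ} {j : ℕ}
    {t : Fin d → Bool} {P : Set (EuclideanSpace ℝ (Fin d))} (hP : P ∈ levelGrid ρ j t) :
    volume P ≠ ∞ := by
  obtain ⟨_, c, r, hr, _, h2, _⟩ := hP
  exact measure_ne_top_of_subset h2 (volume_cube_ne_top c _)

theorem volume_le_twelve_pow_mul {d : ℕ} {c : EuclideanSpace ℝ (Fin d)} {r : ℝ}
    {P : Set (EuclideanSpace ℝ (Fin d))} (h1 : cube c r ⊆ P) :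
    volume (cube c (12 * r)) ≤ 12 ^ d * volume P := by
  rw [volume_cube_mul]
  exact mul_le_mul' le_rfl (measure_mono h1)

/-- The bump quantity is tested on `Q = cube c (12 * r)`, which contains `S`, has comparable volume,
and keeps the centre at which `j` was defined. The exponent of `|S|` is `1 - q e` with `e = α/d +
1/q - 1/p`. -/
theorem IsYoungFunction.lintegral_orliczNorm_le {Φ : ℝ → ℝ} (hΦ : IsYoungFunction Φ) {d n : ℕ}
    {ρ : EuclideanSpace ℝ (Fin d) → ℝ} (hρ : ∀ x, 0 < ρ x) {σ α p q : ℝ} (hσ : 0 ≤ σ)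
    (hαd : α < d) (hd : 0 < (d : ℝ)) (hq : 1 ≤ q) (hpqα : 1 / p - 1 / q ≤ α / d)
    (U V : EuclideanSpace ℝ (Fin d) → Matrix (Fin n) (Fin n) ℂ) {j : ℕ} {t : Fin d → Bool}
    {S : Set (EuclideanSpace ℝ (Fin d))} (hS : S ∈ levelGrid ρ j t) :
    ∫⁻ x in S, orliczNorm Φ S
        (fun y => ‖matCLM (matPow (U x) (1 / q) * matPow (V y) (-1 / q))‖) ^ q ≤
      (ENNReal.ofReal (12 ^ d * 12 ^ d * ((24 * 2 ^ j) ^ σ) ^ (1 - α / d)) *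
        bumpConst ρ σ α p q Φ U V) ^ q * volume S ^ (q / p - q * (α / d)) := by
  have hq0 : 0 < q := by linarith
  have hS0 := volume_ne_zero_of_mem_levelGrid hS
  have hSt := volume_ne_top_of_mem_levelGrid hS
  obtain ⟨-, c, r, hr, hQS, hSQ, -, hj⟩ := hS
  set Q := cube c (12 * r) with hQ
  have hQ0 : volume Q ≠ 0 := volume_cube_ne_zero c (by positivity)
  have hQt : volume Q ≠ ∞ := volume_cube_ne_top c _
  have hQle : volume Q ≤ 12 ^ d * volume S := volume_le_twelve_pow_mul hQS
  have h12 : ENNReal.ofReal (12 ^ d) = 12 ^ d := by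
    rw [ENNReal.ofReal_pow (by norm_num)]; simp
  set N : EuclideanSpace ℝ (Fin d) → Set (EuclideanSpace ℝ (Fin d)) → ℝ≥0∞ := fun x S =>
    orliczNorm Φ S fun y => ‖matCLM (matPow (U x) (1 / q) * matPow (V y) (-1 / q))‖ with hN
  set β := 1 - α / d with hβ
  have hβ0 : 0 < β := by rw [hβ, sub_pos, div_lt_one hd]; exact hαd
  set e := α / d + 1 / q - 1 / p with he
  have he0 : 0 ≤ e := by rw [he]; linarith
  set b := bumpConst ρ σ α p q Φ U V with hb
  set Y := (volume Q)⁻¹ * ∫⁻ x in Q, N x Q ^ q with hY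
  set ψ := psi ρ σ c (12 * r) with hψ
  have hρc := hρ c
  have hψ0 : 0 < ψ := by rw [hψ, psi]; positivity
  -- Indeed `1 + 12 x ≤ 12 (1 + x) < 12 * 2^(j+1)`, with `x = 2 r / ρ c`.
  have hψle : ψ ≤ (24 * 2 ^ j) ^ σ := by
    rw [hψ, psi]
    refine Real.rpow_le_rpow (by positivity) ?_ hσ
    have h1 : 0 < 2 * r / ρ c := by positivity
    have h2 : 2 * (12 * r) / ρ c = 12 * (2 * r / ρ c) := by ring
    rw [pow_succ] at hj
    rw [h2]
    linarith
  have hv : ENNReal.ofReal (volume.real Q) = volume Q := ENNReal.ofReal_toReal hQt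
  have hv0 : 0 < volume.real Q := ENNReal.toReal_pos hQ0 hQt
  have hbump : ENNReal.ofReal (volume.real Q ^ e / ψ ^ β) * Y ^ (1 / q) ≤ b :=
    le_iSup_of_le c (le_iSup_of_le (12 * r) (le_iSup_of_le (by positivity) le_rfl))
  have hcoef : ENNReal.ofReal (volume.real Q ^ e / ψ ^ β) ≠ 0 := by
    simp only [ne_eq, ENNReal.ofReal_eq_zero, not_le]; positivity
  have hY1 : Y ^ (1 / q) ≤ ENNReal.ofReal (ψ ^ β) * volume Q ^ (-e) * b := by
    calc Y ^ (1 / q) ≤ b / ENNReal.ofReal (volume.real Q ^ e / ψ ^ β) := by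
          rw [ENNReal.le_div_iff_mul_le (Or.inl hcoef) (Or.inl ENNReal.ofReal_ne_top), mul_comm]
          exact hbump
      _ = _ := by
          rw [div_eq_mul_inv, ← ENNReal.ofReal_inv_of_pos (by positivity), inv_div, div_eq_mul_inv,
            ENNReal.ofReal_mul (by positivity), ← Real.rpow_neg hv0.le,
            ← ENNReal.ofReal_rpow_of_pos hv0, hv, mul_comm]
  have hY2 : Y ≤ (ENNReal.ofReal (ψ ^ β) * volume Q ^ (-e) * b) ^ q := by
    calc Y = (Y ^ (1 / q)) ^ q := by
          rw [← ENNReal.rpow_mul, one_div_mul_cancel hq0.ne', ENNReal.rpow_one]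
      _ ≤ _ := by gcongr
  have hNle : ∀ x, N x S ≤ 12 ^ d * N x Q := fun x => by
    rw [← h12]
    exact hΦ.orliczNorm_le_mul hSQ hS0 hQt (one_le_pow₀ (by norm_num)) (by rwa [h12]) _
  have h12t : (12 ^ d : ℝ≥0∞) ≠ ∞ := by rw [← h12]; exact ENNReal.ofReal_ne_top
  -- The volume ratio is raised to the power `q` so that it can join the Orlicz factor under one
  -- power; this accounts for `12^d * 12^d`.
  have h12q : (12 ^ d : ℝ≥0∞) ≤ (12 ^ d) ^ q := by
    conv_lhs => rw [← ENNReal.rpow_one (12 ^ d)]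
    refine ENNReal.rpow_le_rpow_of_exponent_le ?_ hq
    exact one_le_pow₀ (by norm_num)
  calc ∫⁻ x in S, N x S ^ q
      ≤ ∫⁻ x in Q, (12 ^ d) ^ q * N x Q ^ q := by
        refine (lintegral_mono fun x => ?_).trans (lintegral_mono_set hSQ)
        rw [← ENNReal.mul_rpow_of_nonneg _ _ hq0.le]
        exact ENNReal.rpow_le_rpow (hNle x) hq0.le
    _ = (12 ^ d) ^ q * (volume Q * Y) := by
        rw [lintegral_const_mul' _ _ (ENNReal.rpow_ne_top_of_nonneg hq0.le h12t), hY, ← mul_assoc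
          (volume Q), ENNReal.mul_inv_cancel hQ0 hQt, one_mul]
    _ ≤ (12 ^ d) ^ q * (12 ^ d * volume S *
          (ENNReal.ofReal (((24 * 2 ^ j) ^ σ) ^ β) * volume S ^ (-e) * b) ^ q) := by
        -- The smaller set has the larger negative power because `e ≥ 0`, that is, `1/p - 1/q ≤
        -- α/d`.
        have h1 : volume Q ^ (-e) ≤ volume S ^ (-e) := by
          rw [ENNReal.rpow_neg, ENNReal.rpow_neg, ENNReal.inv_le_inv]
          exact ENNReal.rpow_le_rpow (measure_mono hSQ) he0
        refine mul_le_mul' le_rfl (mul_le_mul' hQle (hY2.trans ?_))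
        gcongr
    _ ≤ (12 ^ d) ^ q * ((12 ^ d) ^ q * volume S *
          (ENNReal.ofReal (((24 * 2 ^ j) ^ σ) ^ β) * volume S ^ (-e) * b) ^ q) := by
        gcongr
    _ = _ := by
        have h2 : volume S * (volume S ^ (-e)) ^ q = volume S ^ (q / p - q * (α / d)) := by
          conv_lhs => rw [← ENNReal.rpow_one (volume S), ← ENNReal.rpow_mul, ← ENNReal.rpow_mul,
            ← ENNReal.rpow_add _ _ hS0 hSt]
          congr 1
          rw [he]
          field_simp
          ring
        rw [← h2, ENNReal.ofReal_mul (by positivity), ENNReal.ofReal_mul (by positivity), h12]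
        simp only [ENNReal.mul_rpow_of_nonneg _ _ hq0.le]
        ring

theorem coeff_le_of_cube_subset {d : ℕ} {ρ : EuclideanSpace ℝ (Fin d) → ℝ} {θ α : ℝ} (hθ : 0 ≤ θ)
    (hαd : α < d) (hd : 0 < (d : ℝ)) {c : EuclideanSpace ℝ (Fin d)} {r : ℝ} (hr : 0 < r) {j : ℕ}
    (hj : 2 ^ j ≤ 1 + 2 * r / ρ c) {P : Set (EuclideanSpace ℝ (Fin d))} (hQP : cube c r ⊆ P)
    (hPQ : P ⊆ cube c (12 * r)) :
    ENNReal.ofReal (1 / (psi ρ θ c r * volume.real (cube c r)) ^ (1 - α / d)) ≤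
      ENNReal.ofReal ((12 ^ d) ^ (1 - α / d) / ((2 ^ j) ^ θ) ^ (1 - α / d)) *
        volume P ^ (α / d - 1) := by
  have hβ0 : 0 < 1 - α / d := by rw [sub_pos, div_lt_one hd]; exact hαd
  have hPt : volume P ≠ ∞ := measure_ne_top_of_subset hPQ (volume_cube_ne_top c _)
  have hP0 : volume P ≠ 0 := fun h => volume_cube_ne_zero c hr (measure_mono_null hQP h)
  have hv0 : 0 < volume.real P := ENNReal.toReal_pos hP0 hPt
  have hvle : volume.real P / 12 ^ d ≤ volume.real (cube c r) := by
    rw [div_le_iff₀ (by positivity), mul_comm]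
    have h1 : volume P ≤ 12 ^ d * volume (cube c r) := by
      rw [← volume_cube_mul]; exact measure_mono hPQ
    have h2 := ENNReal.toReal_mono
      (ENNReal.mul_ne_top (ENNReal.pow_ne_top (by simp)) (volume_cube_ne_top c r)) h1
    simpa [Measure.real] using h2
  have hψle : (2 ^ j : ℝ) ^ θ ≤ psi ρ θ c r := Real.rpow_le_rpow (by positivity) hj hθ
  have h1 : ENNReal.ofReal (volume.real P) = volume P := ENNReal.ofReal_toReal hPt
  rw [← h1, ENNReal.ofReal_rpow_of_pos hv0, ← ENNReal.ofReal_mul (by positivity)]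
  refine ENNReal.ofReal_le_ofReal ?_
  have h2 : ((2 ^ j : ℝ) ^ θ * (volume.real P / 12 ^ d)) ^ (1 - α / d) ≤
      (psi ρ θ c r * volume.real (cube c r)) ^ (1 - α / d) := by
    refine Real.rpow_le_rpow (by positivity) ?_ hβ0.le
    exact mul_le_mul hψle hvle (by positivity) ((by positivity : (0 : ℝ) ≤ (2 ^ j) ^ θ).trans hψle)
  refine (one_div_le_one_div_of_le (by positivity) h2).trans (le_of_eq ?_)
  rw [Real.mul_rpow (by positivity) (by positivity), Real.div_rpow hv0.le (by positivity),
    show α / d - 1 = -(1 - α / d) by ring, Real.rpow_neg hv0.le]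
  field_simp

theorem rpow_iSup_cube_le {d n : ℕ} {ρ : EuclideanSpace ℝ (Fin d) → ℝ} (hρ : ∀ x, 0 < ρ x)
    {θ α q : ℝ} (hθ : 0 ≤ θ) (hαd : α < d) (hd : 0 < (d : ℝ)) (hq : 0 < q)
    (h : EuclideanSpace ℝ (Fin d) → EuclideanSpace ℂ (Fin n))
    (A : EuclideanSpace ℝ (Fin d) → EuclideanSpace ℂ (Fin n) →L[ℂ] EuclideanSpace ℂ (Fin n))
    (x : EuclideanSpace ℝ (Fin d)) :
    (⨆ (c : EuclideanSpace ℝ (Fin d)) (r : ℝ) (_ : 0 < r) (_ : x ∈ cube c r),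
      ENNReal.ofReal (1 / (psi ρ θ c r * volume.real (cube c r)) ^ (1 - α / d)) *
        opInt volume h (cube c r) (A x)) ^ q ≤
    ∑' j : ℕ, ∑ t : Fin d → Bool,
      ENNReal.ofReal ((12 ^ d) ^ (1 - α / d) / ((2 ^ j) ^ θ) ^ (1 - α / d)) ^ q *
        familyMax volume (α / d) h A (levelGrid ρ j t) x ^ q := by
  set T := ∑' j : ℕ, ∑ t : Fin d → Bool,
      ENNReal.ofReal ((12 ^ d) ^ (1 - α / d) / ((2 ^ j) ^ θ) ^ (1 - α / d)) ^ q *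
        familyMax volume (α / d) h A (levelGrid ρ j t) x ^ q with hT
  have key : (⨆ (c : EuclideanSpace ℝ (Fin d)) (r : ℝ) (_ : 0 < r) (_ : x ∈ cube c r),
      ENNReal.ofReal (1 / (psi ρ θ c r * volume.real (cube c r)) ^ (1 - α / d)) *
        opInt volume h (cube c r) (A x)) ≤ T ^ (1 / q) := by
    refine iSup_le fun c => iSup_le fun r => iSup_le fun hr => iSup_le fun hx => ?_
    have hρc := hρ c
    obtain ⟨j, hj1, hj2⟩ := exists_nat_pow_near (x := 1 + 2 * r / ρ c) (y := (2 : ℝ))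
      (by have : 0 < 2 * r / ρ c := by positivity
          linarith) one_lt_two
    obtain ⟨t, P, hP, hQP, hPQ⟩ := exists_grid_cube c hr
    have hPF : P ∈ levelGrid ρ j t := ⟨hP, c, r, hr, hQP, hPQ, hj1, hj2⟩
    set w := ENNReal.ofReal ((12 ^ d) ^ (1 - α / d) / ((2 ^ j) ^ θ) ^ (1 - α / d)) with hw
    calc ENNReal.ofReal (1 / (psi ρ θ c r * volume.real (cube c r)) ^ (1 - α / d)) *
          opInt volume h (cube c r) (A x)
        ≤ w * volume P ^ (α / d - 1) * opInt volume h P (A x) :=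
          mul_le_mul' (coeff_le_of_cube_subset hθ hαd hd hr hj1 hQP hPQ) (opInt_mono hQP _)
      _ ≤ w * familyMax volume (α / d) h A (levelGrid ρ j t) x := by
          rw [mul_assoc]
          refine mul_le_mul' le_rfl ?_
          refine le_trans (le_of_eq ?_) (le_iSup₂ (f := fun P _ => P.indicator
            (fun x => volume P ^ (α / d - 1) * opInt volume h P (A x)) x) P hPF)
          rw [indicator_of_mem (hQP hx)]
      _ = ((w * familyMax volume (α / d) h A (levelGrid ρ j t) x) ^ q) ^ (1 / q) := by
          rw [← ENNReal.rpow_mul, mul_one_div_cancel hq.ne', ENNReal.rpow_one]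
      _ ≤ T ^ (1 / q) := by
          refine ENNReal.rpow_le_rpow ?_ (by positivity)
          rw [ENNReal.mul_rpow_of_nonneg _ _ hq.le]
          refine le_trans ?_ (ENNReal.le_tsum j)
          exact Finset.single_le_sum (f := fun t => w ^ q *
            familyMax volume (α / d) h A (levelGrid ρ j t) x ^ q) (fun _ _ => zero_le)
            (Finset.mem_univ t)
  calc _ ≤ (T ^ (1 / q)) ^ q := ENNReal.rpow_le_rpow key hq.le
    _ = T := by rw [← ENNReal.rpow_mul, one_div_mul_cancel hq.ne', ENNReal.rpow_one]

/-- The powers of `2^j` combine to a geometric series of ratio `2^((σ - θ) β q) < 1`. This is where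
the gap between the exponents of `ψ` is spent. -/
theorem tsum_coeff_lt_top {d : ℕ} {θ σ β q : ℝ} (hσθ : σ < θ) (hβ : 0 < β) (hq : 0 < q) :
    ∑' j : ℕ, ENNReal.ofReal ((12 ^ d) ^ β / ((2 ^ j) ^ θ) ^ β) ^ q *
      ENNReal.ofReal (12 ^ d * 12 ^ d * ((24 * 2 ^ j) ^ σ) ^ β) ^ q < ∞ := by
  set γ : ℝ := 2 ^ ((σ - θ) * β * q) with hγ
  have hγ0 : 0 < γ := by positivity
  have hγ1 : γ < 1 := by
    refine Real.rpow_lt_one_of_one_lt_of_neg one_lt_two ?_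
    exact mul_neg_of_neg_of_pos (mul_neg_of_neg_of_pos (by linarith) hβ) hq
  set κ : ℝ := ((12 ^ d) ^ β * (12 ^ d * 12 ^ d * ((24 : ℝ) ^ σ) ^ β)) ^ q with hκ
  have hterm : ∀ j : ℕ, ENNReal.ofReal ((12 ^ d) ^ β / ((2 ^ j) ^ θ) ^ β) ^ q *
      ENNReal.ofReal (12 ^ d * 12 ^ d * ((24 * 2 ^ j) ^ σ) ^ β) ^ q =
      ENNReal.ofReal κ * ENNReal.ofReal γ ^ j := by
    intro j
    rw [← ENNReal.mul_rpow_of_nonneg _ _ hq.le, ← ENNReal.ofReal_mul (by positivity),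
      ENNReal.ofReal_rpow_of_pos (by positivity), ← ENNReal.ofReal_pow hγ0.le,
      ← ENNReal.ofReal_mul (by positivity)]
    congr 1
    have h1 : γ ^ j = (((2 ^ j : ℝ) ^ σ) ^ β / ((2 ^ j : ℝ) ^ θ) ^ β) ^ q := by
      have h2 : (0 : ℝ) < 2 ^ j := by positivity
      rw [← Real.rpow_mul h2.le, ← Real.rpow_mul h2.le, ← Real.rpow_sub h2, ← Real.rpow_mul h2.le,
        hγ, ← Real.rpow_natCast, ← Real.rpow_natCast, ← Real.rpow_mul two_pos.le,
        ← Real.rpow_mul two_pos.le]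
      congr 1; ring
    rw [h1, hκ, ← Real.mul_rpow (by positivity) (by positivity)]
    congr 1
    rw [Real.mul_rpow (x := 24) (by norm_num) (by positivity),
      Real.mul_rpow (x := 24 ^ σ) (by positivity) (by positivity)]
    ring
  rw [tsum_congr hterm, ENNReal.tsum_mul_left, ENNReal.tsum_geometric]
  refine ENNReal.mul_lt_top ENNReal.ofReal_lt_top (ENNReal.inv_lt_top.2 (tsub_pos_of_lt ?_))
  rw [← ENNReal.ofReal_one]
  exact (ENNReal.ofReal_lt_ofReal_iff one_pos).2 hγ1

/-! ### Assembly -/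

/-- A measurable representative of `V^(-1/q) f` alters no integral, so the identity holds at every
`x`; only the matrix at `x` stays outside. -/
theorem maximalOp_eq {d n : ℕ} (ρ : EuclideanSpace ℝ (Fin d) → ℝ) (θ α q : ℝ)
    (U V : EuclideanSpace ℝ (Fin d) → Matrix (Fin n) (Fin n) ℂ)
    (f h : EuclideanSpace ℝ (Fin d) → EuclideanSpace ℂ (Fin n))
    (hf : ∀ᵐ y, matCLM (matPow (V y) (-1 / q)) (f y) = h y) (x : EuclideanSpace ℝ (Fin d)) :
    maximalOp ρ θ α q U V f x =
      ⨆ (c : EuclideanSpace ℝ (Fin d)) (r : ℝ) (_ : 0 < r) (_ : x ∈ cube c r),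
        ENNReal.ofReal (1 / (psi ρ θ c r * volume.real (cube c r)) ^ (1 - α / d)) *
          opInt volume h (cube c r) (matCLM (matPow (U x) (1 / q))) := by
  refine iSup_congr fun c => iSup_congr fun r => iSup_congr fun _ => iSup_congr fun _ => ?_
  congr 1
  refine lintegral_congr_ae (ae_restrict_of_ae ?_)
  filter_upwards [hf] with y hy
  rw [matCLM_mul_apply, hy]

theorem aemeasurable_clm_apply {X : Type} [MeasurableSpace X] {μ : Measure X} {n : ℕ}
    {A : X → EuclideanSpace ℂ (Fin n) →L[ℂ] EuclideanSpace ℂ (Fin n)}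
    {f : X → EuclideanSpace ℂ (Fin n)} (hA : AEMeasurable A μ) (hf : AEMeasurable f μ) :
    AEMeasurable (fun x => A x (f x)) μ := by
  have := secondCountableTopology_clm n
  have hc : Continuous fun z : (EuclideanSpace ℂ (Fin n) →L[ℂ] EuclideanSpace ℂ (Fin n)) ×
      EuclideanSpace ℂ (Fin n) => z.1 z.2 := isBoundedBilinearMap_apply.continuous
  exact hc.measurable.comp_aemeasurable (hA.prodMk hf)

theorem mainTheorem4 (d n : ℕ) (C₀ N₀ : ℝ) (hC₀ : 0 < C₀) (hN₀ : 0 < N₀)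
    (θ θ' α p q : ℝ) (hθ' : 0 < θ') (hθ : θ' < θ) (hα : 0 ≤ α) (hαd : α < d)
    (hp : 1 < p) (hpq : p ≤ q) (hpqα : 1 / p - 1 / q ≤ α / d)
    (Φ : ℝ → ℝ) (hΦ : IsYoungFunction Φ) (hB : InBpq p q (complementary Φ)) :
    ∃ C : ℝ≥0, ∀ ρ : EuclideanSpace ℝ (Fin d) → ℝ, IsCriticalRadius C₀ N₀ ρ →
      ∀ U V : EuclideanSpace ℝ (Fin d) → Matrix (Fin n) (Fin n) ℂ,
        IsMatrixWeight U → IsMatrixWeight V →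
        bumpConst ρ (θ' / 3) α p q Φ U V < ∞ →
        ∀ f : EuclideanSpace ℝ (Fin d) → EuclideanSpace ℂ (Fin n),
          MemLp f (ENNReal.ofReal p) volume →
          AEMeasurable (maximalOp ρ θ α q U V f) volume ∧
          (∫⁻ x, maximalOp ρ θ α q U V f x ^ q) ^ (1 / q) ≤
            C * bumpConst ρ (θ' / 3) α p q Φ U V * eLpNorm f (ENNReal.ofReal p) volume := by
  have hd : 0 < (d : ℝ) := lt_of_le_of_lt hα hαd
  have hp0 : 0 < p := by linarith
  have hq1 : 1 ≤ q := by linarith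
  have hq0 : 0 < q := by linarith
  have hβ0 : 0 < 1 - α / d := by rw [sub_pos, div_lt_one hd]; exact hαd
  obtain ⟨C, hC⟩ := hΦ.lintegral_familyMax_le n hp hpq hB
  have hZ := tsum_coeff_lt_top (d := d) (show θ' / 3 < θ by linarith) hβ0 hq0
  set u : ℕ → ℝ≥0∞ := fun j =>
    ENNReal.ofReal ((12 ^ d) ^ (1 - α / d) / ((2 ^ j) ^ θ) ^ (1 - α / d)) with hu
  set v : ℕ → ℝ≥0∞ := fun j =>
    ENNReal.ofReal (12 ^ d * 12 ^ d * ((24 * 2 ^ j) ^ (θ' / 3)) ^ (1 - α / d)) with hv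
  set Z := ∑' j, u j ^ q * v j ^ q with hZdef
  -- `C` is the bound for one grid and one `j`, `2 ^ d` counts the grids, and `Z` sums over `j`.
  set D : ℝ≥0∞ := C * 2 ^ d * Z with hD
  have hDt : D ≠ ∞ := ENNReal.mul_ne_top
    (ENNReal.mul_ne_top ENNReal.coe_ne_top (ENNReal.pow_ne_top (by simp))) hZ.ne
  have hD' : D ^ (1 / q) ≠ ∞ := ENNReal.rpow_ne_top_of_nonneg (by positivity) hDt
  refine ⟨(D ^ (1 / q)).toNNReal, fun ρ hρ U V hU hV _ f hf => ?_⟩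
  rw [ENNReal.coe_toNNReal hD']
  set b := bumpConst ρ (θ' / 3) α p q Φ U V with hb
  have hfm : AEMeasurable f volume := hf.1.aemeasurable
  set A₀ := fun x => matCLM (matPow (U x) (1 / q)) with hA₀
  have hA₀m : AEMeasurable A₀ volume := hU.aemeasurable_matPow (1 / q)
  set A := hA₀m.mk A₀ with hA
  have hh₀m : AEMeasurable (fun y => matCLM (matPow (V y) (-1 / q)) (f y)) volume :=
    aemeasurable_clm_apply (hV.aemeasurable_matPow (-1 / q)) hfm
  set h := hh₀m.mk _ with hh
  have hhm : Measurable h := hh₀m.measurable_mk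
  have hhae := hh₀m.ae_eq_mk
  have hmax := maximalOp_eq ρ θ α q U V f h hhae
  refine ⟨?_, ?_⟩
  · have := secondCountableTopology_clm n
    have h1 := aemeasurable_iSup_cube
      (fun (c : EuclideanSpace ℝ (Fin d)) (r : ℝ) B =>
        ENNReal.ofReal (1 / (psi ρ θ c r * volume.real (cube c r)) ^ (1 - α / d)) *
          opInt volume h (cube c r) B)
      (fun c r => lowerSemicontinuous_const_mul_opInt hhm _ ENNReal.ofReal_ne_top) hA₀m
    exact h1.congr (Eventually.of_forall fun x => (hmax x).symm)
  set f' := hfm.mk f with hf'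
  set φ := fun y => ‖f' y‖ with hφ
  have hφm : Measurable φ := hfm.measurable_mk.norm
  set g := fun x y => ‖matCLM (matPow (U x) (1 / q) * matPow (V y) (-1 / q))‖ with hg
  -- The only use of the operator norm: `|U^(1/q) V^(-1/q) f|` is split into the kernel `g`,
  -- controlled by the bump constant, and `φ = |f|`.
  have hAg : ∀ᵐ x, ∀ᵐ y, ‖A x (h y)‖ ≤ |g x y| * φ y := by
    filter_upwards [hA₀m.ae_eq_mk] with x hx
    filter_upwards [hhae, hfm.ae_eq_mk] with y hy hfy
    rw [hA, ← hx, hh, ← hy, hφ, hf']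
    simp only
    rw [← hfy, hA₀]
    simp only
    rw [← matCLM_mul_apply, hg, abs_of_nonneg (norm_nonneg _)]
    exact ContinuousLinearMap.le_opNorm _ _
  have hfam : ∀ j t, ∫⁻ x, familyMax volume (α / d) h A (levelGrid ρ j t) x ^ q ≤
      C * (v j * b) ^ q * (∫⁻ y, ENNReal.ofReal (φ y) ^ p) ^ (q / p) := fun j t =>
    hC (levelGrid ρ j t) ((countable_grid t).mono (levelGrid_subset_grid ρ j t))
      ((isLaminar_grid t).mono (levelGrid_subset_grid ρ j t))
      (fun P hP => measurableSet_of_mem_grid (levelGrid_subset_grid ρ j t hP))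
      (fun P hP => volume_ne_zero_of_mem_levelGrid hP)
      (fun P hP => volume_ne_top_of_mem_levelGrid hP) h hhm φ hφm (fun y => norm_nonneg _) A
      hA₀m.measurable_mk g hAg (α / d) (by positivity) (v j * b)
      (fun S hS => hΦ.lintegral_orliczNorm_le hρ.pos (by positivity) hαd hd hq1 hpqα U V hS)
  have hfmeas : ∀ j t, Measurable (familyMax volume (α / d) h A (levelGrid ρ j t)) := fun j t =>
    measurable_familyMax volume (α / d) hhm hA₀m.measurable_mk
      ((countable_grid t).mono (levelGrid_subset_grid ρ j t))
      (fun P hP => measurableSet_of_mem_grid (levelGrid_subset_grid ρ j t hP))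
  set I := ∫⁻ y, ENNReal.ofReal (φ y) ^ p with hI
  have hmain : ∫⁻ x, maximalOp ρ θ α q U V f x ^ q ≤ D * b ^ q * I ^ (q / p) := by
    calc ∫⁻ x, maximalOp ρ θ α q U V f x ^ q
        ≤ ∫⁻ x, ∑' j : ℕ, ∑ t : Fin d → Bool,
            u j ^ q * familyMax volume (α / d) h A (levelGrid ρ j t) x ^ q := by
          refine lintegral_mono_ae ?_
          filter_upwards [hA₀m.ae_eq_mk] with x hx
          rw [hmax x]
          have h1 : matCLM (matPow (U x) (1 / q)) = A x := hx
          rw [h1]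
          exact rpow_iSup_cube_le hρ.pos (by linarith) hαd hd hq0 h A x
      _ = ∑' j : ℕ, ∑ t : Fin d → Bool, u j ^ q *
            ∫⁻ x, familyMax volume (α / d) h A (levelGrid ρ j t) x ^ q := by
          rw [lintegral_tsum fun j => (Finset.measurable_fun_sum _ fun t _ =>
            ((hfmeas j t).pow_const q).const_mul _).aemeasurable]
          refine tsum_congr fun j => ?_
          rw [lintegral_finsetSum _ fun t _ => ((hfmeas j t).pow_const q).const_mul _]
          exact Finset.sum_congr rfl fun t _ => lintegral_const_mul _ ((hfmeas j t).pow_const q)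
      _ ≤ ∑' j : ℕ, ∑ _t : Fin d → Bool, u j ^ q * (C * (v j * b) ^ q * I ^ (q / p)) :=
          ENNReal.tsum_le_tsum fun j => Finset.sum_le_sum fun t _ =>
            mul_le_mul' le_rfl (hfam j t)
      _ = ∑' j : ℕ, (u j ^ q * v j ^ q) * (C * 2 ^ d * b ^ q * I ^ (q / p)) := by
          refine tsum_congr fun j => ?_
          rw [Finset.sum_const, Finset.card_univ, Fintype.card_fun, Fintype.card_bool,
            Fintype.card_fin, nsmul_eq_mul, ENNReal.mul_rpow_of_nonneg _ _ hq0.le]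
          push_cast
          ring
      _ = _ := by
          rw [ENNReal.tsum_mul_right, hD]
          ring
  have hnorm : eLpNorm f (ENNReal.ofReal p) volume = I ^ (1 / p) := by
    rw [eLpNorm_eq_lintegral_rpow_enorm_toReal (by simpa using hp0) ENNReal.ofReal_ne_top,
      ENNReal.toReal_ofReal hp0.le]
    congr 1
    refine lintegral_congr_ae ?_
    filter_upwards [hfm.ae_eq_mk] with y hy
    rw [hφ, hf']
    simp only
    rw [← hy, ofReal_norm]
  calc (∫⁻ x, maximalOp ρ θ α q U V f x ^ q) ^ (1 / q)
      ≤ (D * b ^ q * I ^ (q / p)) ^ (1 / q) := ENNReal.rpow_le_rpow hmain (by positivity)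
    _ = D ^ (1 / q) * b * eLpNorm f (ENNReal.ofReal p) volume := by
        rw [ENNReal.mul_rpow_of_nonneg _ _ (by positivity),
          ENNReal.mul_rpow_of_nonneg _ _ (by positivity), ← ENNReal.rpow_mul, ← ENNReal.rpow_mul,
          mul_one_div_cancel hq0.ne', ENNReal.rpow_one, hnorm]
        congr 2
        field_simp
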